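/- **Setting.** Let $T>0$, and let $A,\bar A,Q,\bar Q,S,\bar S$ ($n\times n$), $B,\bar B,N$ ($n\times m$) and $P,\bar P,R,\bar R$ ($m\times m$) be bounded measurable real matrix-valued functions on $[0,T]$ such that $Q_t,\bar Q_t,P_t,\bar P_t$ are symmetric non-negative definite and, for some $\delta>0$, $Q_t+\bar Q_t\ge\delta I$ and $P_t+\bar P_t\ge\delta I$ for all $t\in[0,T]$. Put $$\bar{\mathcal P}=\bar P(I-R),\quad \bar{\mathcal Q}=\bar Q(I-S),\quad \bar{\mathcal R}=N(I-\bar R),\quad \bar{\mathcal S}=N^\top(I-\bar S).$$ Assume that $P_t+\bar{\mathcal P}_t$ is invertible for all $t\in[0,T]$ and that the matrix $$\mathcal A=\begin{pmatrix}A+\bar A-(B+\bar B)(P+\bar{\mathcal P})^{-1}\bar{\mathcal S} & -(B+\bar B)(P+\bar{\mathcal P})^{-1}B^\top\\ -Q-\bar{\mathcal Q}+\bar{\mathcal R}(P+\bar{\mathcal P})^{-1}\bar{\mathcal S} & -A^\top+\bar{\mathcal R}(P+\bar{\mathcal P})^{-1}B^\top\end{pmatrix}$$ is bounded on $[0,T]$.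 These are the standing assumptions on $[0,T]$. Write $M=BP^{-1}B^\top$, let $\|\cdot\|$ be the Euclidean operator norm, and, for a horizon $\tau$ on which $Q,P,M$ are everywhere invertible, let (with values in $[0,\infty]$) $$|\!|\!|K|\!|\!|_{1,\tau}=\sup_{0\le t\le \tau}\|Q_t^{-1/2}K_tQ_t^{-1/2}\|,\quad |\!|\!|K|\!|\!|_{2,\tau}=\sup_{0\le t\le \tau}\|Q_t^{-1/2}K_tM_t^{-1/2}\|,\quad |\!|\!|K|\!|\!|_{3,\tau}=\sup_{0\le t\le \tau}\|M_t^{-1/2}K_tM_t^{-1/2}\|,$$ $$|\!|\!|\phi|\!|\!|_{0,\tau}=\sup_{0\le t\le\tau}\Big(\|M_t^{1/2}\phi(\tau,t)Q_\tau^{1/2}\|^2+\int_t^\tau\|M_t^{1/2}\phi(s,t)Q_s^{1/2}\|^2ds\Big)^{1/2},$$ where $\phi(s,t)$ is the propagator of the adjoint equation $-y'=A^\top y$, i.e. $y_t=\phi(s,t)y_s$ (equivalently, $\phi(s,t)=\Psi(s,t)^\top$ with $\Psi$ the fundamental solution of $x'=Ax$). Put $$a_\tau=|\!|\!|(\bar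 A-(B+\bar B)(P+\bar{\mathcal P})^{-1}\bar{\mathcal S})^\top|\!|\!|_{2,\tau}^2+|\!|\!|(BP^{-1}\bar{\mathcal P}-\bar B)(P+\bar{\mathcal P})^{-1}B^\top|\!|\!|_{3,\tau}^2,$$ $$b_\tau=\big(|\!|\!|\bar{\mathcal Q}|\!|\!|_{1,\tau}+|\!|\!|\bar{\mathcal R}(P+\bar{\mathcal P})^{-1}\bar{\mathcal S}|\!|\!|_{1,\tau}\big)^2+|\!|\!|\bar{\mathcal R}(P+\bar{\mathcal P})^{-1}B^\top|\!|\!|_{2,\tau}^2.$$ **Theorem.** In this setting, assume that one of the following holds. 1. $Q_t,P_t,M_t$ are invertible for all $t\in[0,T]$, and $a_T+b_T<1$. 2. For some $T_0>0$ the coefficients are given on $[0,T_0]$ and satisfy the standing assumptions there, $Q_t,P_t,M_t$ are invertible for all $t\in[0,T_0]$, $a_{T_0}\ne0$, $b_{T_0}<1$ and $$T<T_0\wedge\left(\frac{1}{|\!|\!|\phi|\!|\!|_{0,T}\sqrt{a_{T_0}}}\cdot\frac{1-\sqrt{b_{T_0}}}{1+\sqrt{b_{T_0}}}\right)^2 .$$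 3. $K_1>0$, $K_2>0$ and $K_3+K_4+2K_2K_5<2K_1K_2$, where, with $\mathrm{sym}(X)=\frac12(X+X^\top)$, $$K_1=\inf_{[0,T]}\lambda_{\min}(\mathrm{sym}(Q_t+\bar{\mathcal Q}_t)),\qquad K_2=\inf_{[0,T]}\lambda_{\min}\big(\mathrm{sym}((B_t+\bar B_t)(P_t+\bar{\mathcal P}_t)^{-1}B_t^\top)\big),$$ $$K_3=\sup_{[0,T]}\sigma_{\max}\big(\bar A_t-(B_t+\bar B_t)(P_t+\bar{\mathcal P}_t)^{-1}\bar{\mathcal S}_t\big)^2,\qquad K_4=\sup_{[0,T]}\sigma_{\max}\big(\bar{\mathcal R}_t(P_t+\bar{\mathcal P}_t)^{-1}B_t^\top\big)^2,$$ $$K_5=\sup_{[0,T]}\lambda_{\max}\big(\mathrm{sym}(\bar{\mathcal R}_t(P_t+\bar{\mathcal P}_t)^{-1}\bar{\mathcal S}_t)\big).$$ Then the non-symmetric Riccati equation $$\frac{d\Gamma_t}{dt}+\Gamma_t\big(A_t+\bar A_t-(B_t+\bar B_t)(P_t+\bar{\mathcal P}_t)^{-1}\bar{\mathcal S}_t\big)+\big(A_t^\top-\bar{\mathcal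 R}_t(P_t+\bar{\mathcal P}_t)^{-1}B_t^\top\big)\Gamma_t-\Gamma_t(B_t+\bar B_t)(P_t+\bar{\mathcal P}_t)^{-1}B_t^\top\Gamma_t+Q_t+\bar{\mathcal Q}_t-\bar{\mathcal R}_t(P_t+\bar{\mathcal P}_t)^{-1}\bar{\mathcal S}_t=0,$$ $$\Gamma_T=Q_T+\bar{\mathcal Q}_T,$$ has exactly one absolutely continuous solution on $[0,T]$ (the equation holding for almost every $t$). If $\Phi(t,s)$ is the fundamental solution of $x'=\mathcal A x$ (which exists), then for every $t\in[0,T]$ the matrix $(Q_T+\bar{\mathcal Q}_T,-I)\,\Phi(T,t)\binom0I$ is invertible and $$\Gamma_t=-\Big[(Q_T+\bar{\mathcal Q}_T,-I)\,\Phi(T,t)\tbinom0I\Big]^{-1}\Big[(Q_T+\bar{\mathcal Q}_T,-I)\,\Phi(T,t)\tbinom I0\Big].$$ Moreover $\eta_t=\Gamma_t\xi_t$ on $[0,T]$ for every solution $(\xi,\eta)$ of the forward-backward system $\frac{d}{dt}\binom{\xi}{\eta}=\mathcal A\binom{\xi}{\eta}$, $\xi(0)=x_0$, $\eta_T=(Q_T+\bar{\mathcal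 Q}_T)\xi_T$. -/

import Mathlib

open MeasureTheory Set
open scoped Matrix Matrix.Norms.L2Operator MatrixOrder ENNReal

noncomputable section

/-- The time-dependent coefficients of the linear-quadratic extended mean field game with
`n`-dimensional state and `m`-dimensional control. The names `Abar`, `Bbar`, `Qbar`, `Pbar`,
`Sbar`, `Rbar` stand for the barred letters. -/
structure LQCoeff (n m : ℕ) where
  A : ℝ → Matrix (Fin n) (Fin n) ℝ
  Abar : ℝ → Matrix (Fin n) (Fin n) ℝ
  B : ℝ → Matrix (Fin n) (Fin m) ℝ
  Bbar : ℝ → Matrix (Fin n) (Fin m) ℝ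
  Q : ℝ → Matrix (Fin n) (Fin n) ℝ
  Qbar : ℝ → Matrix (Fin n) (Fin n) ℝ
  P : ℝ → Matrix (Fin m) (Fin m) ℝ
  Pbar : ℝ → Matrix (Fin m) (Fin m) ℝ
  S : ℝ → Matrix (Fin n) (Fin n) ℝ
  Sbar : ℝ → Matrix (Fin n) (Fin n) ℝ
  R : ℝ → Matrix (Fin m) (Fin m) ℝ
  Rbar : ℝ → Matrix (Fin m) (Fin m) ℝ
  N : ℝ → Matrix (Fin n) (Fin m) ℝ

/-- A bounded, (Lebesgue) measurable matrix-valued function on `[0,T]`. -/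
def IsBoundedMeasurable {ι κ : Type*} (T : ℝ) (F : ℝ → Matrix ι κ ℝ) : Prop :=
  (∀ i j, AEMeasurable (fun t => F t i j) (volume.restrict (Icc 0 T))) ∧
    ∃ C : ℝ, ∀ t ∈ Icc 0 T, ∀ i j, |F t i j| ≤ C

/-- `Φ` is the fundamental solution on `[0,T]` of the linear system `x' = F x` (with bounded
measurable `F`): `∂ₜ Φ(t,s) = F(t) Φ(t,s)`, `Φ(s,s) = I`, in integrated form, so that
`x(t) = Φ(t,s) x(s)` for every solution `x`. -/
def IsFundamentalSolution {ι : Type*} [Fintype ι] [DecidableEq ι] (T : ℝ)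
    (F : ℝ → Matrix ι ι ℝ) (Φ : ℝ → ℝ → Matrix ι ι ℝ) : Prop :=
  ∀ s ∈ Icc 0 T, ContinuousOn (fun t => Φ t s) (Icc 0 T) ∧
    ∀ t ∈ Icc 0 T, Φ t s = 1 + ∫ r in s..t, F r * Φ r s

/-- The smallest eigenvalue of a real symmetric matrix. -/
def lambdaMin {n : ℕ} (M : Matrix (Fin n) (Fin n) ℝ) : ℝ := sInf (spectrum ℝ M)

/-- The largest eigenvalue of a real symmetric matrix. -/
def lambdaMax {n : ℕ} (M : Matrix (Fin n) (Fin n) ℝ) : ℝ := sSup (spectrum ℝ M)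

/-- The largest singular value of a real matrix. -/
def sigmaMax {n : ℕ} (M : Matrix (Fin n) (Fin n) ℝ) : ℝ := Real.sqrt (lambdaMax (Mᵀ * M))

/-- The symmetric part of a real square matrix. -/
def symPart {n : ℕ} (M : Matrix (Fin n) (Fin n) ℝ) : Matrix (Fin n) (Fin n) ℝ :=
  (1 / 2 : ℝ) • (M + Mᵀ)

namespace LQCoeff

variable {n m : ℕ} (c : LQCoeff n m)

/-- `P̄ₜ (I - Rₜ)`. -/
def calP (t : ℝ) : Matrix (Fin m) (Fin m) ℝ := c.Pbar t * (1 - c.R t)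

/-- `Q̄ₜ (I - Sₜ)`. -/
def calQ (t : ℝ) : Matrix (Fin n) (Fin n) ℝ := c.Qbar t * (1 - c.S t)

/-- `Nₜ (I - R̄ₜ)`. -/
def calR (t : ℝ) : Matrix (Fin n) (Fin m) ℝ := c.N t * (1 - c.Rbar t)

/-- `Nₜᵀ (I - S̄ₜ)`. -/
def calS (t : ℝ) : Matrix (Fin m) (Fin n) ℝ := (c.N t)ᵀ * (1 - c.Sbar t)

/-- `(Pₜ + P̄ₜ (I - Rₜ))⁻¹`. -/
def invP (t : ℝ) : Matrix (Fin m) (Fin m) ℝ := (c.P t + c.calP t)⁻¹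

/-- The mean field perturbation of the drift, `Ā - (B + B̄)(P + 𝒫)⁻¹ 𝒮`. -/
def driftPert (t : ℝ) : Matrix (Fin n) (Fin n) ℝ :=
  c.Abar t - (c.B t + c.Bbar t) * c.invP t * c.calS t

/-- `(B + B̄)(P + 𝒫)⁻¹ Bᵀ`. -/
def BB (t : ℝ) : Matrix (Fin n) (Fin n) ℝ := (c.B t + c.Bbar t) * c.invP t * (c.B t)ᵀ

/-- `ℛ (P + 𝒫)⁻¹ Bᵀ`. -/
def RB (t : ℝ) : Matrix (Fin n) (Fin n) ℝ := c.calR t * c.invP t * (c.B t)ᵀ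

/-- `ℛ (P + 𝒫)⁻¹ 𝒮`. -/
def RS (t : ℝ) : Matrix (Fin n) (Fin n) ℝ := c.calR t * c.invP t * c.calS t

/-- `B P⁻¹ Bᵀ`. -/
def BPB (t : ℝ) : Matrix (Fin n) (Fin n) ℝ := c.B t * (c.P t)⁻¹ * (c.B t)ᵀ

/-- `(B P⁻¹ 𝒫 - B̄)(P + 𝒫)⁻¹ Bᵀ`. -/
def controlPert (t : ℝ) : Matrix (Fin n) (Fin n) ℝ :=
  (c.B t * (c.P t)⁻¹ * c.calP t - c.Bbar t) * c.invP t * (c.B t)ᵀ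

/-- The matrix of the forward-backward system, `d/dt (ξ, η) = 𝒜ₜ (ξ, η)`. -/
def hamiltonian (t : ℝ) : Matrix (Fin n ⊕ Fin n) (Fin n ⊕ Fin n) ℝ :=
  Matrix.fromBlocks (c.A t + c.driftPert t) (-(c.BB t))
    (-(c.Q t) - c.calQ t + c.RS t) (-(c.A t)ᵀ + c.RB t)

/-- The standing assumptions on `[0,T]`: bounded measurable coefficients; `Q, Q̄, P, P̄`
symmetric non-negative definite with `Q + Q̄ ≥ δ I` and `P + P̄ ≥ δ I` for some `δ > 0`; and the
forward-backward system makes sense with bounded coefficients, that is `P + 𝒫` is invertible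
and `𝒜` is bounded. -/
structure Admissible (T : ℝ) : Prop where
  A_bdd : IsBoundedMeasurable T c.A
  Abar_bdd : IsBoundedMeasurable T c.Abar
  B_bdd : IsBoundedMeasurable T c.B
  Bbar_bdd : IsBoundedMeasurable T c.Bbar
  Q_bdd : IsBoundedMeasurable T c.Q
  Qbar_bdd : IsBoundedMeasurable T c.Qbar
  P_bdd : IsBoundedMeasurable T c.P
  Pbar_bdd : IsBoundedMeasurable T c.Pbar
  S_bdd : IsBoundedMeasurable T c.S
  Sbar_bdd : IsBoundedMeasurable T c.Sbar
  R_bdd : IsBoundedMeasurable T c.R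
  Rbar_bdd : IsBoundedMeasurable T c.Rbar
  N_bdd : IsBoundedMeasurable T c.N
  Q_nonneg : ∀ t ∈ Icc 0 T, (c.Q t).PosSemidef
  Qbar_nonneg : ∀ t ∈ Icc 0 T, (c.Qbar t).PosSemidef
  P_nonneg : ∀ t ∈ Icc 0 T, (c.P t).PosSemidef
  Pbar_nonneg : ∀ t ∈ Icc 0 T, (c.Pbar t).PosSemidef
  coercive : ∃ δ : ℝ, 0 < δ ∧ ∀ t ∈ Icc 0 T,
    (c.Q t + c.Qbar t - δ • (1 : Matrix (Fin n) (Fin n) ℝ)).PosSemidef ∧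
    (c.P t + c.Pbar t - δ • (1 : Matrix (Fin m) (Fin m) ℝ)).PosSemidef
  isUnit_P_add : ∀ t ∈ Icc 0 T, IsUnit (c.P t + c.calP t)
  hamiltonian_bdd : ∃ C : ℝ, ∀ t ∈ Icc 0 T, ∀ i j, |c.hamiltonian t i j| ≤ C

/-! ### Weighted norms

Here `‖·‖ₑ` is the Euclidean operator norm, with values in `[0,∞]`, so that an infinite supremum
is really `∞`. -/

/-- `Q, P` and `B P⁻¹ Bᵀ` are invertible on `[0,T]`. -/
def WeightsInvertible (T : ℝ) : Prop :=
  ∀ t ∈ Icc 0 T, IsUnit (c.Q t) ∧ IsUnit (c.P t) ∧ IsUnit (c.BPB t)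

/-- `sup_{0 ≤ t ≤ T} ( ‖(B P⁻¹ Bᵀ)ₜ^{1/2} φ(T,t) Q_T^{1/2}‖²
    + ∫ₜᵀ ‖(B P⁻¹ Bᵀ)ₜ^{1/2} φ(s,t) Qₛ^{1/2}‖² ds )^{1/2}`. -/
def norm0 (T : ℝ) (φ : ℝ → ℝ → Matrix (Fin n) (Fin n) ℝ) : ℝ≥0∞ :=
  ⨆ t ∈ Icc 0 T,
    (‖CFC.sqrt (c.BPB t) * φ T t * CFC.sqrt (c.Q T)‖ₑ ^ 2 +
      ∫⁻ s in Icc t T, ‖CFC.sqrt (c.BPB t) * φ s t * CFC.sqrt (c.Q s)‖ₑ ^ 2) ^ (1 / 2 : ℝ)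

/-- `sup_{0 ≤ t ≤ T} ‖Q^{-1/2} K Q^{-1/2}‖`. -/
def norm1 (T : ℝ) (K : ℝ → Matrix (Fin n) (Fin n) ℝ) : ℝ≥0∞ :=
  ⨆ t ∈ Icc 0 T, ‖(CFC.sqrt (c.Q t))⁻¹ * K t * (CFC.sqrt (c.Q t))⁻¹‖ₑ

/-- `sup_{0 ≤ t ≤ T} ‖Q^{-1/2} K (B P⁻¹ Bᵀ)^{-1/2}‖`. -/
def norm2 (T : ℝ) (K : ℝ → Matrix (Fin n) (Fin n) ℝ) : ℝ≥0∞ :=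
  ⨆ t ∈ Icc 0 T, ‖(CFC.sqrt (c.Q t))⁻¹ * K t * (CFC.sqrt (c.BPB t))⁻¹‖ₑ

/-- `sup_{0 ≤ t ≤ T} ‖(B P⁻¹ Bᵀ)^{-1/2} K (B P⁻¹ Bᵀ)^{-1/2}‖`. -/
def norm3 (T : ℝ) (K : ℝ → Matrix (Fin n) (Fin n) ℝ) : ℝ≥0∞ :=
  ⨆ t ∈ Icc 0 T, ‖(CFC.sqrt (c.BPB t))⁻¹ * K t * (CFC.sqrt (c.BPB t))⁻¹‖ₑ

/-- Squared size of the perturbations of the forward equation. -/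
def fwdSize (T : ℝ) : ℝ≥0∞ :=
  c.norm2 T (fun t => (c.driftPert t)ᵀ) ^ 2 + c.norm3 T c.controlPert ^ 2

/-- Squared size of the perturbations of the backward equation. -/
def bwdSize (T : ℝ) : ℝ≥0∞ :=
  (c.norm1 T c.calQ + c.norm1 T c.RS) ^ 2 + c.norm2 T c.RB ^ 2

/-- Condition 1: the mean field coefficients are small. -/
def Condition1 (T : ℝ) : Prop :=
  c.WeightsInvertible T ∧
    c.norm2 T (fun t => (c.driftPert t)ᵀ) ^ 2 + c.norm3 T c.controlPert ^ 2 +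
      c.norm2 T c.RB ^ 2 + (c.norm1 T c.calQ + c.norm1 T c.RS) ^ 2 < 1

/-- Condition 2: the backward perturbations are small and the horizon is short. In `norm0` the
propagator is `φ(s,t) = Ψ(s,t)ᵀ` with `Ψ` the fundamental solution of `x' = A x`; thus
`ηₜ = φ(s,t) ηₛ` for every solution of the adjoint equation `-η' = Aᵀ η`. -/
def Condition2 (T : ℝ) : Prop :=
  ∃ T₀ : ℝ, c.Admissible T₀ ∧ c.WeightsInvertible T₀ ∧
    c.fwdSize T₀ ≠ 0 ∧ c.bwdSize T₀ < 1 ∧ T < T₀ ∧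
    ∃ Ψ : ℝ → ℝ → Matrix (Fin n) (Fin n) ℝ, IsFundamentalSolution T c.A Ψ ∧
      ENNReal.ofReal T <
        (1 / (c.norm0 T (fun s t => (Ψ s t)ᵀ) * c.fwdSize T₀ ^ (1 / 2 : ℝ)) *
          ((1 - c.bwdSize T₀ ^ (1 / 2 : ℝ)) / (1 + c.bwdSize T₀ ^ (1 / 2 : ℝ)))) ^ 2

def K1 (T : ℝ) : ℝ := ⨅ t : Icc (0 : ℝ) T, lambdaMin (symPart (c.Q t + c.calQ t))

def K2 (T : ℝ) : ℝ := ⨅ t : Icc (0 : ℝ) T, lambdaMin (symPart (c.BB t))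

def K3 (T : ℝ) : ℝ := ⨆ t : Icc (0 : ℝ) T, sigmaMax (c.driftPert t) ^ 2

def K4 (T : ℝ) : ℝ := ⨆ t : Icc (0 : ℝ) T, sigmaMax (c.RB t) ^ 2

def K5 (T : ℝ) : ℝ := ⨆ t : Icc (0 : ℝ) T, lambdaMax (symPart (c.RS t))

/-- Condition 3: monotonicity. -/
def Condition3 (T : ℝ) : Prop :=
  0 < c.K1 T ∧ 0 < c.K2 T ∧
    c.K3 T + c.K4 T + 2 * c.K2 T * c.K5 T < 2 * c.K1 T * c.K2 T

/-- The terminal matrix `Q_T + Q̄_T (I - S_T)`. -/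
def terminal (T : ℝ) : Matrix (Fin n) (Fin n) ℝ := c.Q T + c.calQ T

/-- The expression `F` in the Riccati equation `dΓ/dt + F(t,Γ) = 0`. -/
def riccatiRHS (t : ℝ) (Γ : Matrix (Fin n) (Fin n) ℝ) : Matrix (Fin n) (Fin n) ℝ :=
  Γ * (c.A t + c.driftPert t) + ((c.A t)ᵀ - c.RB t) * Γ - Γ * c.BB t * Γ +
    (c.Q t + c.calQ t - c.RS t)

/-- `Γ` solves the Riccati equation on `[0,T]` with its terminal condition, in the sense of
Carathéodory (an absolutely continuous function that satisfies the equation almost everywhere),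
written as the equivalent integral equation for a continuous `Γ`. -/
def IsRiccatiSolution (T : ℝ) (Γ : ℝ → Matrix (Fin n) (Fin n) ℝ) : Prop :=
  ContinuousOn Γ (Icc 0 T) ∧
    ∀ t ∈ Icc 0 T, Γ t = c.terminal T + ∫ s in t..T, c.riccatiRHS s (Γ s)

/-- `(ξ, η)` solves the forward-backward system on `[0,T]` with `ξ(0) = x₀` and
`η(T) = (Q_T + 𝒬_T) ξ(T)`, in the sense of Carathéodory. -/
def IsFBODESolution (T : ℝ) (x₀ : Fin n → ℝ) (ξ η : ℝ → Fin n → ℝ) : Prop :=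
  ContinuousOn ξ (Icc 0 T) ∧ ContinuousOn η (Icc 0 T) ∧
    (∀ t ∈ Icc 0 T, ξ t = x₀ + ∫ s in (0 : ℝ)..t,
      ((c.A s + c.driftPert s) *ᵥ ξ s - c.BB s *ᵥ η s)) ∧
    ∀ t ∈ Icc 0 T, η t = c.terminal T *ᵥ ξ T + ∫ s in t..T,
      ((c.Q s + c.calQ s - c.RS s) *ᵥ ξ s + ((c.A s)ᵀ - c.RB s) *ᵥ η s)

/-- `(Q_T + 𝒬_T, -I) Φ(T,t) (0; I)`. -/
def lowerBlock (T : ℝ) (Φ : ℝ → ℝ → Matrix (Fin n ⊕ Fin n) (Fin n ⊕ Fin n) ℝ) (t : ℝ) :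
    Matrix (Fin n) (Fin n) ℝ :=
  (Matrix.fromCols (c.terminal T) (-1) : Matrix (Fin n) (Fin n ⊕ Fin n) ℝ) * Φ T t *
    (Matrix.fromRows 0 1 : Matrix (Fin n ⊕ Fin n) (Fin n) ℝ)

/-- `(Q_T + 𝒬_T, -I) Φ(T,t) (I; 0)`. -/
def upperBlock (T : ℝ) (Φ : ℝ → ℝ → Matrix (Fin n ⊕ Fin n) (Fin n ⊕ Fin n) ℝ) (t : ℝ) :
    Matrix (Fin n) (Fin n) ℝ :=
  (Matrix.fromCols (c.terminal T) (-1) : Matrix (Fin n) (Fin n ⊕ Fin n) ℝ) * Φ T t *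
    (Matrix.fromRows 1 0 : Matrix (Fin n ⊕ Fin n) (Fin n) ℝ)

end LQCoeff

end

/-! The Riccati equation is the projective form of the linear system with matrix 𝒜. Let `U` and `L`
be the blocks of (Q_T + 𝒬_T, -I) Φ(T,t). Along every solution (ξ, η) the vector Uξ + Lη is constant,
and the terminal condition says that this constant is 0. Hence, once every L_t is invertible, Γ =
-L⁻¹U solves the Riccati equation and η = Γξ (`isMatrixACDeriv_riccati`,
`IsHamiltonianFlow.blocks_mulVec_eq`). For any other solution Γ' the matrix U + LΓ' satisfies a
homogeneous linear equation and vanishes at T, so it is zero (`upper_add_lower_mul_eq_zero`).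

The kernel of L_t consists of those y for which the flow through (0, y) at time t meets the terminal
condition. It is therefore enough that ξ = 0 at t₀ together with the terminal condition forces η = 0
at t₀ (`isUnit_lowerBlock`, `riccati_of_unique`). This uniqueness is where the three conditions
enter.

The tool is the energy ξ·η, whose derivative does not involve A. Integrated from t₀, where it
vanishes, it gives ξ_T·(Q_T + 𝒬_T)ξ_T = ∫ `energyRate`. Under conditions 1 and 3 the left side is
non-negative, while the rate is non-positive and vanishes only if η does; so η = 0 almost
everywhere, hence everywhere by continuity. For condition 3 the rate is handled by completing a
square in Euclidean norms. For condition 1 it is minus the weight |Q^{1/2}ξ|² + |M^{1/2}η|², plus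
terms controlled by the weighted norms.

Under condition 2 the forward perturbations need not be small. Put α = √a, β = √b, let N be the
propagator norm, and let X be |Q_T^{1/2}ξ_T|² plus the integral of the weight over [t₀,T]. Variation
of constants gives |M^{1/2}η|² ≤ N²(1+β)²X at every time (`normM_sq_le`). Inserted into the energy
identity this yields (1-β)X ≤ α√T N(1+β)X, and the short horizon forces X = 0 (`eq_zero_of_short`).
-/

/-! ### Measurable and bounded matrix functions -/

/-- Entrywise (Lebesgue) measurability of a matrix-valued function on `[0,T]`. -/
def EntrywiseMeasurable {ι κ : Type*} (T : ℝ) (F : ℝ → Matrix ι κ ℝ) : Prop :=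
  ∀ i j, AEMeasurable (fun t => F t i j) (volume.restrict (Icc 0 T))

namespace EntrywiseMeasurable

variable {ι κ l : Type*} {T : ℝ}

lemma add {F G : ℝ → Matrix ι κ ℝ} (hF : EntrywiseMeasurable T F)
    (hG : EntrywiseMeasurable T G) : EntrywiseMeasurable T (fun t => F t + G t) :=
  fun i j => (hF i j).add (hG i j)

lemma sub {F G : ℝ → Matrix ι κ ℝ} (hF : EntrywiseMeasurable T F)
    (hG : EntrywiseMeasurable T G) : EntrywiseMeasurable T (fun t => F t - G t) :=
  fun i j => (hF i j).sub (hG i j)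

lemma neg {F : ℝ → Matrix ι κ ℝ} (hF : EntrywiseMeasurable T F) :
    EntrywiseMeasurable T (fun t => -F t) :=
  fun i j => (hF i j).neg

lemma const (M : Matrix ι κ ℝ) : EntrywiseMeasurable T (fun _ => M) :=
  fun _ _ => aemeasurable_const

lemma transpose {F : ℝ → Matrix ι κ ℝ} (hF : EntrywiseMeasurable T F) :
    EntrywiseMeasurable T (fun t => (F t)ᵀ) :=
  fun i j => hF j i

lemma mul [Fintype κ] {F : ℝ → Matrix ι κ ℝ} {G : ℝ → Matrix κ l ℝ}
    (hF : EntrywiseMeasurable T F) (hG : EntrywiseMeasurable T G) :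
    EntrywiseMeasurable T (fun t => F t * G t) := by
  intro i j
  simp only [Matrix.mul_apply]
  exact Finset.aemeasurable_fun_sum _ fun k _ => (hF i k).mul (hG k j)

lemma det [Fintype ι] [DecidableEq ι] {F : ℝ → Matrix ι ι ℝ} (hF : EntrywiseMeasurable T F) :
    AEMeasurable (fun t => (F t).det) (volume.restrict (Icc 0 T)) := by
  simp only [Matrix.det_apply']
  exact Finset.aemeasurable_fun_sum _ fun σ _ =>
    (Finset.aemeasurable_fun_prod _ fun i _ => hF _ _).const_mul _

/-- Cramer's rule: the entries are quotients of determinants. Invertibility is not needed, since the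
default inverse of a singular matrix is 0, in agreement with 0⁻¹ = 0 for the determinant. -/
lemma inv [Fintype ι] [DecidableEq ι] {F : ℝ → Matrix ι ι ℝ} (hF : EntrywiseMeasurable T F) :
    EntrywiseMeasurable T (fun t => (F t)⁻¹) := by
  intro i j
  simp only [Matrix.inv_def, Ring.inverse_eq_inv', Matrix.smul_apply, smul_eq_mul,
    Matrix.adjugate_apply]
  refine hF.det.inv.mul (det fun k l' => ?_)
  by_cases hk : k = j
  · subst hk
    simp only [Matrix.updateRow_self]
    exact aemeasurable_const
  · simp only [Matrix.updateRow_ne hk]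
    exact hF k l'

lemma aestronglyMeasurable [Fintype ι] [Fintype κ] [DecidableEq ι] [DecidableEq κ]
    {F : ℝ → Matrix ι κ ℝ} (hF : EntrywiseMeasurable T F) :
    AEStronglyMeasurable F (volume.restrict (Icc 0 T)) := by
  have : F = fun t => ∑ i, ∑ j, F t i j • Matrix.single i j (1 : ℝ) := by
    ext1 t
    conv_lhs => rw [Matrix.matrix_eq_sum_single (F t)]
    simp
  rw [this]
  exact Finset.aestronglyMeasurable_fun_sum _ fun i _ =>
    Finset.aestronglyMeasurable_fun_sum _ fun j _ =>
      (hF i j).aestronglyMeasurable.smul_const _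

end EntrywiseMeasurable

namespace IsBoundedMeasurable

variable {ι κ l : Type*} {T : ℝ}

lemma entrywiseMeasurable {F : ℝ → Matrix ι κ ℝ} (hF : IsBoundedMeasurable T F) :
    EntrywiseMeasurable T F := hF.1

lemma add {F G : ℝ → Matrix ι κ ℝ} (hF : IsBoundedMeasurable T F)
    (hG : IsBoundedMeasurable T G) : IsBoundedMeasurable T (fun t => F t + G t) := by
  obtain ⟨C, hC⟩ := hF.2
  obtain ⟨D, hD⟩ := hG.2
  exact ⟨hF.entrywiseMeasurable.add hG.1, C + D, fun t ht i j =>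
    (abs_add_le _ _).trans (add_le_add (hC t ht i j) (hD t ht i j))⟩

lemma neg {F : ℝ → Matrix ι κ ℝ} (hF : IsBoundedMeasurable T F) :
    IsBoundedMeasurable T (fun t => -F t) := by
  obtain ⟨C, hC⟩ := hF.2
  exact ⟨hF.entrywiseMeasurable.neg, C, fun t ht i j => by
    simpa using hC t ht i j⟩

lemma sub {F G : ℝ → Matrix ι κ ℝ} (hF : IsBoundedMeasurable T F)
    (hG : IsBoundedMeasurable T G) : IsBoundedMeasurable T (fun t => F t - G t) := by
  simpa only [sub_eq_add_neg] using hF.add hG.neg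

lemma const [Finite ι] [Finite κ] (M : Matrix ι κ ℝ) : IsBoundedMeasurable T (fun _ => M) := by
  cases nonempty_fintype ι
  cases nonempty_fintype κ
  refine ⟨EntrywiseMeasurable.const M, ∑ i, ∑ j, |M i j|, fun _ _ i j => ?_⟩
  exact (Finset.single_le_sum (f := fun j => |M i j|) (fun _ _ => abs_nonneg _)
    (Finset.mem_univ j)).trans (Finset.single_le_sum (f := fun i => ∑ j, |M i j|)
      (fun _ _ => Finset.sum_nonneg fun _ _ => abs_nonneg _) (Finset.mem_univ i))

lemma transpose {F : ℝ → Matrix ι κ ℝ} (hF : IsBoundedMeasurable T F) :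
    IsBoundedMeasurable T (fun t => (F t)ᵀ) := by
  obtain ⟨C, hC⟩ := hF.2
  exact ⟨hF.entrywiseMeasurable.transpose, C, fun t ht i j => hC t ht j i⟩

lemma mul [Fintype κ] {F : ℝ → Matrix ι κ ℝ} {G : ℝ → Matrix κ l ℝ}
    (hF : IsBoundedMeasurable T F) (hG : IsBoundedMeasurable T G) :
    IsBoundedMeasurable T (fun t => F t * G t) := by
  obtain ⟨C, hC⟩ := hF.2
  obtain ⟨D, hD⟩ := hG.2
  refine ⟨hF.entrywiseMeasurable.mul hG.1, ∑ _k : κ, C * D, fun t ht i j => ?_⟩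
  simp only [Matrix.mul_apply]
  refine (Finset.abs_sum_le_sum_abs _ _).trans (Finset.sum_le_sum fun k _ => ?_)
  rw [abs_mul]
  exact mul_le_mul (hC t ht i k) (hD t ht k j) (abs_nonneg _)
    ((abs_nonneg _).trans (hC t ht i k))

lemma of_continuousOn [Finite ι] [Finite κ] {F : ℝ → Matrix ι κ ℝ}
    (hF : ∀ i j, ContinuousOn (fun t => F t i j) (Icc 0 T)) : IsBoundedMeasurable T F := by
  cases nonempty_fintype ι
  cases nonempty_fintype κ
  refine ⟨fun i j => (hF i j).aemeasurable measurableSet_Icc, ?_⟩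
  choose C hC using fun i j => isCompact_Icc.exists_bound_of_continuousOn (hF i j)
  refine ⟨∑ i, ∑ j, |C i j|, fun t ht i j => ?_⟩
  refine ((hC i j t ht).trans (le_abs_self _)).trans ?_
  exact (Finset.single_le_sum (f := fun j => |C i j|) (fun _ _ => abs_nonneg _)
    (Finset.mem_univ j)).trans (Finset.single_le_sum (f := fun i => ∑ j, |C i j|)
      (fun _ _ => Finset.sum_nonneg fun _ _ => abs_nonneg _) (Finset.mem_univ i))

lemma integrableOn {F : ℝ → Matrix ι κ ℝ} (hF : IsBoundedMeasurable T F) (i : ι) (j : κ) :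
    IntegrableOn (fun t => F t i j) (Icc 0 T) := by
  obtain ⟨C, hC⟩ := hF.2
  exact IntegrableOn.of_bound measure_Icc_lt_top (hF.1 i j).aestronglyMeasurable C
    ((ae_restrict_iff' measurableSet_Icc).2 (.of_forall fun t ht => hC t ht i j))

lemma exists_norm_le [Fintype ι] [Fintype κ] [DecidableEq ι] [DecidableEq κ]
    {F : ℝ → Matrix ι κ ℝ} (hF : IsBoundedMeasurable T F) :
    ∃ C, 0 ≤ C ∧ ∀ t ∈ Icc 0 T, ‖F t‖ ≤ C := by
  obtain ⟨C, hC⟩ := hF.2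
  refine ⟨∑ i, ∑ j, |C| * ‖Matrix.single (α := ℝ) (i : ι) (j : κ) 1‖,
    Finset.sum_nonneg fun _ _ => Finset.sum_nonneg fun _ _ => by positivity, fun t ht => ?_⟩
  rw [Matrix.matrix_eq_sum_single (F t)]
  refine (norm_sum_le _ _).trans (Finset.sum_le_sum fun i _ => (norm_sum_le _ _).trans
    (Finset.sum_le_sum fun j _ => ?_))
  rw [show Matrix.single i j (F t i j) = F t i j • Matrix.single i j (1 : ℝ) by simp, norm_smul]
  exact mul_le_mul_of_nonneg_right ((hC t ht i j).trans (le_abs_self C)) (norm_nonneg _)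

end IsBoundedMeasurable

/-! ### Absolutely continuous functions -/

/-- `f` is absolutely continuous on `[0,T]` with almost everywhere derivative `f'`. -/
structure IsACDeriv (T : ℝ) (f f' : ℝ → ℝ) : Prop where
  integrableOn : IntegrableOn f' (Icc 0 T)
  eq_add : ∀ t ∈ Icc 0 T, f t = f 0 + ∫ s in (0 : ℝ)..t, f' s

namespace IsACDeriv

variable {T : ℝ} {f f' g g' : ℝ → ℝ}

lemma intervalIntegrable (h : IsACDeriv T f f') {s t : ℝ} (hs : s ∈ Icc 0 T)
    (ht : t ∈ Icc 0 T) : IntervalIntegrable f' volume s t :=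
  (h.integrableOn.mono_set (uIcc_subset_Icc hs ht)).intervalIntegrable

lemma integral_eq_sub (h : IsACDeriv T f f') {s t : ℝ} (hs : s ∈ Icc 0 T)
    (ht : t ∈ Icc 0 T) : ∫ r in s..t, f' r = f t - f s := by
  have h0 : (0 : ℝ) ∈ Icc 0 T := ⟨le_rfl, hs.1.trans hs.2⟩
  rw [h.eq_add t ht, h.eq_add s hs,
    ← intervalIntegral.integral_add_adjacent_intervals (h.intervalIntegrable h0 hs)
      (h.intervalIntegrable hs ht)]
  ring

lemma of_eq_add (h : IntegrableOn f' (Icc 0 T)) {s : ℝ} (hs : s ∈ Icc 0 T)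
    (hf : ∀ t ∈ Icc 0 T, f t = f s + ∫ r in s..t, f' r) : IsACDeriv T f f' := by
  have h0 : (0 : ℝ) ∈ Icc 0 T := ⟨le_rfl, hs.1.trans hs.2⟩
  refine ⟨h, fun t ht => ?_⟩
  have hi : ∀ {a b}, a ∈ Icc 0 T → b ∈ Icc 0 T → IntervalIntegrable f' volume a b :=
    fun ha hb => (h.mono_set (uIcc_subset_Icc ha hb)).intervalIntegrable
  rw [hf t ht, hf 0 h0, ← intervalIntegral.integral_add_adjacent_intervals (hi hs h0) (hi h0 ht)]
  ring

lemma continuousOn (h : IsACDeriv T f f') : ContinuousOn f (Icc 0 T) := by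
  rcases lt_or_ge T 0 with hT | hT
  · simp [Icc_eq_empty hT.not_ge]
  have := intervalIntegral.continuousOn_primitive_interval (μ := volume) (f := f') (a := 0) (b := T)
    (by rw [uIcc_of_le hT]; exact h.integrableOn)
  rw [uIcc_of_le hT] at this
  exact (this.const_add (f 0)).congr h.eq_add

lemma congr (h : IsACDeriv T f f') (hfg : ∀ t ∈ Icc 0 T, f t = g t)
    (hfg' : ∀ t ∈ Icc 0 T, f' t = g' t) : IsACDeriv T g g' := by
  refine ⟨h.integrableOn.congr_fun hfg' measurableSet_Icc, fun t ht => ?_⟩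
  have h0 : (0 : ℝ) ∈ Icc 0 T := ⟨le_rfl, ht.1.trans ht.2⟩
  rw [← hfg t ht, ← hfg 0 h0, h.eq_add t ht]
  congr 1
  exact intervalIntegral.integral_congr fun r hr => hfg' r (uIcc_subset_Icc h0 ht hr)

lemma const (a : ℝ) : IsACDeriv T (fun _ => a) (fun _ => 0) :=
  ⟨by simp [IntegrableOn], by simp⟩

lemma add (hf : IsACDeriv T f f') (hg : IsACDeriv T g g') :
    IsACDeriv T (fun t => f t + g t) (fun t => f' t + g' t) := by
  refine ⟨hf.integrableOn.add hg.integrableOn, fun t ht => ?_⟩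
  have h0 : (0 : ℝ) ∈ Icc 0 T := ⟨le_rfl, ht.1.trans ht.2⟩
  rw [intervalIntegral.integral_add (hf.intervalIntegrable h0 ht) (hg.intervalIntegrable h0 ht),
    hf.eq_add t ht, hg.eq_add t ht]
  ring

lemma neg (hf : IsACDeriv T f f') : IsACDeriv T (fun t => -f t) (fun t => -f' t) := by
  refine ⟨hf.integrableOn.neg, fun t ht => ?_⟩
  rw [intervalIntegral.integral_neg, hf.eq_add t ht]
  ring

lemma sum {κ : Type*} (S : Finset κ) {f f' : κ → ℝ → ℝ} (h : ∀ k ∈ S, IsACDeriv T (f k) (f' k)) :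
    IsACDeriv T (fun t => ∑ k ∈ S, f k t) (fun t => ∑ k ∈ S, f' k t) := by
  classical
  induction S using Finset.induction_on with
  | empty => simpa using const 0
  | insert k S hk ih =>
    simp only [Finset.sum_insert hk]
    exact (h k (by simp)).add (ih fun k' hk' => h k' (by simp [hk']))

/-- Integration by parts for absolutely continuous functions. It is applied to the primitives `f 0 +
∫ f'`, because `f` itself is only prescribed on [0,T] and may behave arbitrarily outside. -/
lemma mul (hf : IsACDeriv T f f') (hg : IsACDeriv T g g') :
    IsACDeriv T (fun t => f t * g t) (fun t => f' t * g t + f t * g' t) := by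
  refine ⟨(hf.integrableOn.mul_continuousOn hg.continuousOn isCompact_Icc).add
    (hg.integrableOn.continuousOn_mul hf.continuousOn isCompact_Icc), fun t ht => ?_⟩
  have h0 : (0 : ℝ) ∈ Icc 0 T := ⟨le_rfl, ht.1.trans ht.2⟩
  have key : ∀ {f f' : ℝ → ℝ}, IsACDeriv T f f' →
      AbsolutelyContinuousOnInterval (fun x => f 0 + ∫ r in (0 : ℝ)..x, f' r) 0 t ∧
      ∀ᵐ x, x ∈ uIcc 0 t → deriv (fun x => f 0 + ∫ r in (0 : ℝ)..x, f' r) x = f' x := by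
    intro f f' h
    have hi := h.intervalIntegrable h0 ht
    refine ⟨AbsolutelyContinuousOnInterval.add (f := fun _ => f 0)
      ((LipschitzWith.const (f 0)).lipschitzOnWith.absolutelyContinuousOnInterval)
      (hi.absolutelyContinuousOnInterval_intervalIntegral (by simp)), ?_⟩
    filter_upwards [hi.ae_hasDerivAt_integral] with x hx hxt
    exact ((hx hxt 0 (by simp)).const_add (f 0)).deriv
  obtain ⟨f1, f2⟩ := key hf
  obtain ⟨g1, g2⟩ := key hg
  have := f1.integral_deriv_mul_eq_sub g1
  simp only [intervalIntegral.integral_same, add_zero, ← hf.eq_add t ht, ← hg.eq_add t ht] at this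
  rw [← sub_eq_iff_eq_add', ← this]
  refine intervalIntegral.integral_congr_ae ?_
  filter_upwards [f2, g2] with x hx1 hx2 hx
  have hx' := uIoc_subset_uIcc hx
  have hxT := uIcc_subset_Icc h0 ht hx'
  rw [hx1 hx', hx2 hx', hf.eq_add x hxT, hg.eq_add x hxT]

lemma eq_of_deriv_eq_zero (hf : IsACDeriv T f f') (h : ∀ t ∈ Icc 0 T, f' t = 0) {s t : ℝ}
    (hs : s ∈ Icc 0 T) (ht : t ∈ Icc 0 T) : f s = f t := by
  have := hf.integral_eq_sub hs ht
  rw [intervalIntegral.integral_congr (g := fun _ => (0 : ℝ))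
    fun r hr => h r (uIcc_subset_Icc hs ht hr)] at this
  simp only [intervalIntegral.integral_zero] at this
  linarith

end IsACDeriv

/-- `F` is entrywise absolutely continuous on `[0,T]` with almost everywhere derivative `F'`. -/
def IsMatrixACDeriv {ι κ : Type*} (T : ℝ) (F F' : ℝ → Matrix ι κ ℝ) : Prop :=
  ∀ i j, IsACDeriv T (fun t => F t i j) (fun t => F' t i j)

lemma IsBoundedMeasurable.integrableOn_matrix {ι κ : Type*} [Fintype ι] [Fintype κ]
    [DecidableEq ι] [DecidableEq κ] {T : ℝ} {F : ℝ → Matrix ι κ ℝ}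
    (hF : IsBoundedMeasurable T F) : IntegrableOn F (Icc 0 T) := by
  obtain ⟨C, -, hC⟩ := hF.exists_norm_le
  exact IntegrableOn.of_bound measure_Icc_lt_top hF.entrywiseMeasurable.aestronglyMeasurable C
    ((ae_restrict_iff' measurableSet_Icc).2 (.of_forall hC))

lemma intervalIntegral_matrix_apply {ι κ : Type*} [Fintype ι] [Fintype κ]
    [DecidableEq ι] [DecidableEq κ] {F : ℝ → Matrix ι κ ℝ} {a b : ℝ}
    (hF : ∀ i j, IntervalIntegrable (fun t => F t i j) volume a b) (i : ι) (j : κ) :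
    (∫ t in a..b, F t) i j = ∫ t in a..b, F t i j := by
  have h : IntervalIntegrable F volume a b := by
    have : F = fun t => ∑ i, ∑ j, F t i j • Matrix.single i j (1 : ℝ) := by
      ext1 t
      conv_lhs => rw [Matrix.matrix_eq_sum_single (F t)]
      simp
    rw [this]
    refine ⟨integrable_finsetSum _ fun i _ => integrable_finsetSum _ fun j _ =>
      (hF i j).1.smul_const _, integrable_finsetSum _ fun i _ => integrable_finsetSum _ fun j _ =>
      (hF i j).2.smul_const _⟩
  exact ((LinearMap.toContinuousLinearMap
    (Matrix.entryLinearMap ℝ ℝ i j)).intervalIntegral_comp_comm h).symm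

namespace IsMatrixACDeriv

variable {ι κ l : Type*} {T : ℝ}

lemma mul [Fintype κ] {F F' : ℝ → Matrix ι κ ℝ} {G G' : ℝ → Matrix κ l ℝ}
    (hF : IsMatrixACDeriv T F F') (hG : IsMatrixACDeriv T G G') :
    IsMatrixACDeriv T (fun t => F t * G t) (fun t => F' t * G t + F t * G' t) := by
  intro i j
  simp only [Matrix.mul_apply, Matrix.add_apply, ← Finset.sum_add_distrib]
  exact IsACDeriv.sum _ fun k _ => (hF i k).mul (hG k j)

lemma add {F F' G G' : ℝ → Matrix ι κ ℝ}
    (hF : IsMatrixACDeriv T F F') (hG : IsMatrixACDeriv T G G') :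
    IsMatrixACDeriv T (fun t => F t + G t) (fun t => F' t + G' t) :=
  fun i j => (hF i j).add (hG i j)

lemma neg {F F' : ℝ → Matrix ι κ ℝ} (hF : IsMatrixACDeriv T F F') :
    IsMatrixACDeriv T (fun t => -F t) (fun t => -F' t) :=
  fun i j => (hF i j).neg

lemma transpose {F F' : ℝ → Matrix ι κ ℝ} (hF : IsMatrixACDeriv T F F') :
    IsMatrixACDeriv T (fun t => (F t)ᵀ) (fun t => (F' t)ᵀ) :=
  fun i j => hF j i

lemma const (M : Matrix ι κ ℝ) : IsMatrixACDeriv T (fun _ => M) (fun _ => 0) :=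
  fun _ _ => .const _

lemma congr {F F' G G' : ℝ → Matrix ι κ ℝ} (hF : IsMatrixACDeriv T F F')
    (h : ∀ t ∈ Icc 0 T, F t = G t) (h' : ∀ t ∈ Icc 0 T, F' t = G' t) :
    IsMatrixACDeriv T G G' :=
  fun i j => (hF i j).congr (fun t ht => by rw [h t ht]) (fun t ht => by rw [h' t ht])

lemma congr_deriv {F F' G' : ℝ → Matrix ι κ ℝ} (hF : IsMatrixACDeriv T F F')
    (h' : ∀ t ∈ Icc 0 T, F' t = G' t) : IsMatrixACDeriv T F G' :=
  hF.congr (fun _ _ => rfl) h'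

lemma const_mul [Fintype κ] (M : Matrix ι κ ℝ) {F F' : ℝ → Matrix κ l ℝ}
    (hF : IsMatrixACDeriv T F F') : IsMatrixACDeriv T (fun t => M * F t) (fun t => M * F' t) :=
  ((const M).mul hF).congr_deriv fun t _ => by simp

lemma mul_const [Fintype κ] {F F' : ℝ → Matrix ι κ ℝ} (hF : IsMatrixACDeriv T F F')
    (M : Matrix κ l ℝ) : IsMatrixACDeriv T (fun t => F t * M) (fun t => F' t * M) :=
  (hF.mul (const M)).congr_deriv fun t _ => by simp

lemma eq_of_deriv_eq_zero {F F' : ℝ → Matrix ι κ ℝ} (hF : IsMatrixACDeriv T F F')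
    (h : ∀ t ∈ Icc 0 T, F' t = 0) {s t : ℝ} (hs : s ∈ Icc 0 T) (ht : t ∈ Icc 0 T) :
    F s = F t := by
  ext i j
  exact (hF i j).eq_of_deriv_eq_zero (fun r hr => by simp [h r hr]) hs ht

lemma isBoundedMeasurable [Finite ι] [Finite κ] {F F' : ℝ → Matrix ι κ ℝ}
    (hF : IsMatrixACDeriv T F F') : IsBoundedMeasurable T F :=
  .of_continuousOn fun i j => (hF i j).continuousOn

lemma continuousOn {F F' : ℝ → Matrix ι κ ℝ}
    (hF : IsMatrixACDeriv T F F') : ContinuousOn F (Icc 0 T) :=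
  continuousOn_pi.2 fun i => continuousOn_pi.2 fun j => (hF i j).continuousOn

variable [Fintype ι] [Fintype κ] [DecidableEq ι] [DecidableEq κ]

lemma eq_add_integral {F F' : ℝ → Matrix ι κ ℝ} (hF : IsMatrixACDeriv T F F') {s t : ℝ}
    (hs : s ∈ Icc 0 T) (ht : t ∈ Icc 0 T) : F t = F s + ∫ r in s..t, F' r := by
  ext i j
  rw [Matrix.add_apply, intervalIntegral_matrix_apply fun i j => (hF i j).intervalIntegrable hs ht,
    (hF i j).integral_eq_sub hs ht]
  ring

lemma of_eq_add {F F' : ℝ → Matrix ι κ ℝ} (hF' : IsBoundedMeasurable T F') {s : ℝ}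
    (hs : s ∈ Icc 0 T) (h : ∀ t ∈ Icc 0 T, F t = F s + ∫ r in s..t, F' r) :
    IsMatrixACDeriv T F F' := by
  refine fun i j => .of_eq_add (hF'.integrableOn i j) hs fun t ht => ?_
  conv_lhs => rw [h t ht]
  rw [Matrix.add_apply, intervalIntegral_matrix_apply fun i j =>
    ((hF'.integrableOn i j).mono_set (uIcc_subset_Icc hs ht)).intervalIntegrable]

end IsMatrixACDeriv

/-! ### Linear equations with bounded measurable coefficients -/

section LinearEquation

variable {ι : Type*} [Fintype ι] [DecidableEq ι] {T : ℝ}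

/-- Carathéodory existence for `X' = H X`, `X(0) = I`, with bounded measurable `H`. -/
theorem IsBoundedMeasurable.exists_isMatrixACDeriv (hT : 0 ≤ T) {H : ℝ → Matrix ι ι ℝ}
    (hH : IsBoundedMeasurable T H) :
    ∃ X, IsMatrixACDeriv T X (fun t => H t * X t) ∧ X 0 = 1 := by
  obtain ⟨C, hC0, hC⟩ := hH.exists_norm_le
  -- Picard iteration for y = e^{-as}X in the supremum norm. The exponential weight makes the map
  -- Lipschitz with constant C/a ≤ 1/2 on all of [0,T], so no subdivision of the interval is needed.
  set a : ℝ := 2 * C + 1 with ha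
  have ha0 : 0 < a := by positivity
  let E := C(Icc (0 : ℝ) T, Matrix ι ι ℝ)
  let z : E → ℝ → Matrix ι ι ℝ := fun y s => Real.exp (a * s) • IccExtend hT y s
  have hzc : ∀ y, Continuous (z y) := fun y =>
    (by fun_prop : Continuous fun s : ℝ => Real.exp (a * s)).smul y.continuous.Icc_extend'
  have hz : ∀ y, IsBoundedMeasurable T (fun s => H s * z y s) := fun y =>
    hH.mul (.of_continuousOn fun i j => ((hzc y).matrix_elem i j).continuousOn)
  have hint : ∀ y {t}, t ∈ Icc 0 T → IntervalIntegrable (fun s => H s * z y s) volume 0 t :=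
    fun y t ht => ((hz y).integrableOn_matrix.mono_set
      (uIcc_subset_Icc ⟨le_rfl, hT⟩ ht)).intervalIntegrable
  have hcont : ∀ y, Continuous fun t : Icc (0 : ℝ) T =>
      Real.exp (-(a * t)) • (1 + ∫ s in (0 : ℝ)..t, H s * z y s) := by
    intro y
    have h1 := intervalIntegral.continuousOn_primitive_interval (μ := volume)
      (f := fun s => H s * z y s) (a := 0) (b := T)
      (by rw [uIcc_of_le hT]; exact (hz y).integrableOn_matrix)
    rw [uIcc_of_le hT] at h1
    have h2 := continuousOn_iff_continuous_domRestrict.1 h1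
    exact (by fun_prop : Continuous fun t : Icc (0 : ℝ) T => Real.exp (-(a * t))).smul
      (continuous_const.add h2)
  let W : E → E := fun y => ⟨_, hcont y⟩
  have hW : ContractingWith (1 / 2) W := by
    refine ⟨by norm_num [← NNReal.coe_lt_coe], LipschitzWith.of_dist_le_mul fun x y => ?_⟩
    refine (ContinuousMap.dist_le (by positivity)).2 fun t => ?_
    have ht := t.2
    change dist (Real.exp (-(a * t)) • (1 + ∫ s in (0 : ℝ)..t, H s * z x s))
      (Real.exp (-(a * t)) • (1 + ∫ s in (0 : ℝ)..t, H s * z y s)) ≤ _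
    rw [dist_eq_norm, ← smul_sub, add_sub_add_left_eq_sub,
      ← intervalIntegral.integral_sub (hint x ht) (hint y ht), norm_smul, Real.norm_eq_abs,
      Real.abs_exp]
    have hb : ‖∫ s in (0 : ℝ)..t, (H s * z x s - H s * z y s)‖ ≤
        ∫ s in (0 : ℝ)..t, C * dist x y * Real.exp (a * s) := by
      refine intervalIntegral.norm_integral_le_of_norm_le ht.1 (.of_forall fun s hs => ?_)
        ((by fun_prop : Continuous fun s : ℝ => C * dist x y * Real.exp (a * s)).intervalIntegrable
          _ _)
      have hsT : s ∈ Icc 0 T := ⟨hs.1.le, hs.2.trans ht.2⟩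
      rw [← mul_sub, ← smul_sub, mul_smul_comm, norm_smul, Real.norm_eq_abs, Real.abs_exp,
        mul_comm]
      refine mul_le_mul_of_nonneg_right ((norm_mul_le _ _).trans ?_) (Real.exp_pos _).le
      refine mul_le_mul (hC s hsT) ?_ (norm_nonneg _) hC0
      rw [← dist_eq_norm]
      exact ContinuousMap.dist_apply_le_dist _
    have hi : ∫ s in (0 : ℝ)..t, C * dist x y * Real.exp (a * s) =
        C * dist x y * ((Real.exp (a * t) - 1) / a) := by
      rw [intervalIntegral.integral_const_mul,
        intervalIntegral.integral_comp_mul_left (fun s => Real.exp s) ha0.ne', integral_exp]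
      simp [div_eq_inv_mul]
    rw [hi] at hb
    refine (mul_le_mul_of_nonneg_left hb (Real.exp_pos _).le).trans ?_
    have he : Real.exp (-(a * t)) * Real.exp (a * t) = 1 := by
      rw [← Real.exp_add]; simp
    have hca : C / a ≤ 1 / 2 := by
      rw [div_le_iff₀ ha0]; linarith
    calc Real.exp (-(a * t)) * (C * dist x y * ((Real.exp (a * t) - 1) / a))
        = C / a * dist x y * (1 - Real.exp (-(a * t))) := by
          linear_combination (C * dist x y / a) * he
      _ ≤ C / a * dist x y * 1 := by
          refine mul_le_mul_of_nonneg_left (by linarith [Real.exp_pos (-(a * (t : ℝ)))]) (by positivity)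
      _ ≤ _ := by
          rw [mul_one]
          exact mul_le_mul_of_nonneg_right (by simpa using hca) dist_nonneg
  obtain ⟨y, hy⟩ : ∃ y, W y = y := ⟨_, hW.fixedPoint_isFixedPt⟩
  have hzy : ∀ t ∈ Icc 0 T, z y t = 1 + ∫ s in (0 : ℝ)..t, H s * z y s := by
    intro t ht
    have h1 : y ⟨t, ht⟩ = Real.exp (-(a * t)) • (1 + ∫ s in (0 : ℝ)..t, H s * z y s) := by
      conv_lhs => rw [← hy]
      rfl
    change Real.exp (a * t) • IccExtend hT y t = _
    rw [IccExtend_of_mem hT _ ht, h1, smul_smul, ← Real.exp_add]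
    simp
  have hz0 : z y 0 = 1 := by simpa using hzy 0 ⟨le_rfl, hT⟩
  refine ⟨z y, .of_eq_add (hz y) ⟨le_rfl, hT⟩ fun t ht => ?_, hz0⟩
  rw [hz0]
  exact hzy t ht

/-- A bounded measurable linear system has a solution matrix `X` with inverse `Y`. -/
theorem IsBoundedMeasurable.exists_isMatrixACDeriv_inverse (hT : 0 ≤ T) {H : ℝ → Matrix ι ι ℝ}
    (hH : IsBoundedMeasurable T H) :
    ∃ X Y, IsMatrixACDeriv T X (fun t => H t * X t) ∧
      IsMatrixACDeriv T Y (fun t => -(Y t * H t)) ∧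
      ∀ t ∈ Icc 0 T, X t * Y t = 1 ∧ Y t * X t = 1 := by
  obtain ⟨X, hX, hX0⟩ := hH.exists_isMatrixACDeriv hT
  -- The inverse is built as the transpose of a solution of the adjoint equation Z' = -HᵀZ: then
  -- (ZᵀX)' = 0, and ZᵀX = 1 at time 0.
  obtain ⟨Z, hZ, hZ0⟩ := hH.transpose.neg.exists_isMatrixACDeriv hT
  have hY : IsMatrixACDeriv T (fun t => (Z t)ᵀ) (fun t => -((Z t)ᵀ * H t)) :=
    hZ.transpose.congr_deriv fun t _ => by simp [Matrix.transpose_mul]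
  refine ⟨X, fun t => (Z t)ᵀ, hX, hY, fun t ht => ?_⟩
  have h : (Z t)ᵀ * X t = 1 := by
    rw [(hY.mul hX).eq_of_deriv_eq_zero (fun t _ => by simp [mul_assoc]) ht ⟨le_rfl, hT⟩]
    simp [hX0, hZ0]
  exact ⟨mul_eq_one_comm.1 h, h⟩

end LinearEquation

namespace IsFundamentalSolution

variable {ι : Type*} [Fintype ι] [DecidableEq ι] {T : ℝ} {H : ℝ → Matrix ι ι ℝ}
  {Φ : ℝ → ℝ → Matrix ι ι ℝ}

lemma apply_self (h : IsFundamentalSolution T H Φ) {s : ℝ} (hs : s ∈ Icc 0 T) : Φ s s = 1 := by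
  simpa using (h s hs).2 s hs

lemma isMatrixACDeriv (h : IsFundamentalSolution T H Φ) (hH : IsBoundedMeasurable T H) {s : ℝ}
    (hs : s ∈ Icc 0 T) : IsMatrixACDeriv T (fun t => Φ t s) (fun t => H t * Φ t s) := by
  have hΦ : IsBoundedMeasurable T (fun t => Φ t s) := .of_continuousOn fun i j =>
    continuousOn_pi.1 (continuousOn_pi.1 (h s hs).1 i) j
  refine .of_eq_add (hH.mul hΦ) hs fun t ht => ?_
  rw [h.apply_self hs]
  exact (h s hs).2 t ht

lemma of_isMatrixACDeriv {X Y : ℝ → Matrix ι ι ℝ} (hX : IsMatrixACDeriv T X (fun t => H t * X t))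
    (hXY : ∀ t ∈ Icc 0 T, X t * Y t = 1) :
    IsFundamentalSolution T H (fun t s => X t * Y s) := by
  intro s hs
  have h := hX.mul_const (Y s)
  refine ⟨h.continuousOn, fun t ht => ?_⟩
  have h1 := h.eq_add_integral hs ht
  rw [hXY s hs] at h1
  simpa only [mul_assoc] using h1

/-- `Y t * Φ t s` is constant in `t` and equals `Y s` at `t = s`. Besides uniqueness of the
fundamental solution, this gives its regularity in the second argument, on which
`IsFundamentalSolution` imposes nothing directly. -/
lemma eq_mul (h : IsFundamentalSolution T H Φ) (hH : IsBoundedMeasurable T H)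
    {X Y : ℝ → Matrix ι ι ℝ} (hY : IsMatrixACDeriv T Y (fun t => -(Y t * H t)))
    (hXY : ∀ t ∈ Icc 0 T, X t * Y t = 1) {s t : ℝ} (hs : s ∈ Icc 0 T) (ht : t ∈ Icc 0 T) :
    Φ t s = X t * Y s := by
  have := (hY.mul (h.isMatrixACDeriv hH hs)).eq_of_deriv_eq_zero
    (fun t _ => by simp [mul_assoc]) ht hs
  simp only [h.apply_self hs, mul_one] at this
  rw [← this, ← mul_assoc, hXY t ht, one_mul]

end IsFundamentalSolution

/-! ### Absolutely continuous vector functions -/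

/-- `v` is componentwise absolutely continuous on `[0,T]` with almost everywhere derivative `v'`. -/
def IsVectorACDeriv {ι : Type*} (T : ℝ) (v v' : ℝ → ι → ℝ) : Prop :=
  ∀ i, IsACDeriv T (fun t => v t i) (fun t => v' t i)

namespace IsVectorACDeriv

variable {ι κ : Type*} {T : ℝ}

lemma congr_deriv {v v' w' : ℝ → ι → ℝ} (h : IsVectorACDeriv T v v')
    (h' : ∀ t ∈ Icc 0 T, v' t = w' t) : IsVectorACDeriv T v w' :=
  fun i => (h i).congr (fun _ _ => rfl) (fun t ht => by rw [h' t ht])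

lemma continuousOn {v v' : ℝ → ι → ℝ} (h : IsVectorACDeriv T v v') :
    ContinuousOn v (Icc 0 T) :=
  continuousOn_pi.2 fun i => (h i).continuousOn

lemma add {v v' w w' : ℝ → ι → ℝ} (hv : IsVectorACDeriv T v v') (hw : IsVectorACDeriv T w w') :
    IsVectorACDeriv T (fun t => v t + w t) (fun t => v' t + w' t) :=
  fun i => (hv i).add (hw i)

lemma dotProduct [Fintype ι] {v v' w w' : ℝ → ι → ℝ} (hv : IsVectorACDeriv T v v')
    (hw : IsVectorACDeriv T w w') :
    IsACDeriv T (fun t => v t ⬝ᵥ w t) (fun t => v' t ⬝ᵥ w t + v t ⬝ᵥ w' t) := by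
  simp only [_root_.dotProduct, ← Finset.sum_add_distrib]
  exact IsACDeriv.sum _ fun i _ => (hv i).mul (hw i)

lemma mulVec [Fintype κ] {F F' : ℝ → Matrix ι κ ℝ} {v v' : ℝ → κ → ℝ}
    (hF : IsMatrixACDeriv T F F') (hv : IsVectorACDeriv T v v') :
    IsVectorACDeriv T (fun t => F t *ᵥ v t) (fun t => F' t *ᵥ v t + F t *ᵥ v' t) :=
  fun i => dotProduct (hF i) hv

lemma const (w : ι → ℝ) : IsVectorACDeriv T (fun _ => w) (fun _ => 0) :=
  fun _ => .const _

lemma mulVec_const [Fintype κ] {F F' : ℝ → Matrix ι κ ℝ} (hF : IsMatrixACDeriv T F F')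
    (w : κ → ℝ) : IsVectorACDeriv T (fun t => F t *ᵥ w) (fun t => F' t *ᵥ w) :=
  (mulVec hF (const w)).congr_deriv fun t _ => by simp

lemma eq_of_deriv_eq_zero {v v' : ℝ → ι → ℝ} (hv : IsVectorACDeriv T v v')
    (h : ∀ t ∈ Icc 0 T, v' t = 0) {s t : ℝ} (hs : s ∈ Icc 0 T) (ht : t ∈ Icc 0 T) :
    v s = v t :=
  funext fun i => (hv i).eq_of_deriv_eq_zero (fun r hr => by simp [h r hr]) hs ht

lemma of_eq_add [Fintype ι] {v v' : ℝ → ι → ℝ}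
    (hv' : ∀ i, IntegrableOn (fun t => v' t i) (Icc 0 T)) {s : ℝ}
    (hs : s ∈ Icc 0 T) (h : ∀ t ∈ Icc 0 T, v t = v s + ∫ r in s..t, v' r) :
    IsVectorACDeriv T v v' := by
  refine fun i => .of_eq_add (hv' i) hs fun t ht => ?_
  conv_lhs => rw [h t ht]
  have hi : IntervalIntegrable v' volume s t :=
    (IntegrableOn.mono_set (t := Icc 0 T) (Integrable.of_eval hv')
      (uIcc_subset_Icc hs ht)).intervalIntegrable
  rw [Pi.add_apply]
  congr 1
  exact ((ContinuousLinearMap.proj (R := ℝ) (φ := fun _ : ι => ℝ)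
    i).intervalIntegral_comp_comm hi).symm

end IsVectorACDeriv

lemma IsBoundedMeasurable.integrableOn_mulVec {ι κ : Type*} [Finite ι] [Fintype κ] {T : ℝ}
    {F : ℝ → Matrix ι κ ℝ} (hF : IsBoundedMeasurable T F) {v : ℝ → κ → ℝ}
    (hv : ContinuousOn v (Icc 0 T)) (i : ι) :
    IntegrableOn (fun t => (F t *ᵥ v t) i) (Icc 0 T) := by
  have h := hF.mul (IsBoundedMeasurable.of_continuousOn
    (F := fun t => Matrix.replicateCol Unit (v t)) fun i _ => continuousOn_pi.1 hv i)
  exact h.integrableOn i ()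

lemma IsBoundedMeasurable.submatrix {ι κ ι' κ' : Type*} {T : ℝ} {F : ℝ → Matrix ι κ ℝ}
    (hF : IsBoundedMeasurable T F) (e : ι' → ι) (f : κ' → κ) :
    IsBoundedMeasurable T (fun t => (F t).submatrix e f) :=
  ⟨fun _ _ => hF.1 _ _, hF.2.imp fun _ h t ht _ _ => h t ht _ _⟩

/-! ### Regularity of the coefficients -/

namespace LQCoeff

variable {n m : ℕ} {c : LQCoeff n m} {T : ℝ}

namespace Admissible

lemma invP_measurable (hc : c.Admissible T) : EntrywiseMeasurable T c.invP :=
  (hc.P_bdd.entrywiseMeasurable.add (hc.Pbar_bdd.entrywiseMeasurable.mul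
    ((EntrywiseMeasurable.const 1).sub hc.R_bdd.1))).inv

lemma calQ_bdd (hc : c.Admissible T) : IsBoundedMeasurable T c.calQ :=
  hc.Qbar_bdd.mul ((IsBoundedMeasurable.const 1).sub hc.S_bdd)

lemma calR_bdd (hc : c.Admissible T) : IsBoundedMeasurable T c.calR :=
  hc.N_bdd.mul ((IsBoundedMeasurable.const 1).sub hc.Rbar_bdd)

lemma calS_bdd (hc : c.Admissible T) : IsBoundedMeasurable T c.calS :=
  hc.N_bdd.transpose.mul ((IsBoundedMeasurable.const 1).sub hc.Sbar_bdd)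

lemma BPB_measurable (hc : c.Admissible T) : EntrywiseMeasurable T c.BPB :=
  (hc.B_bdd.entrywiseMeasurable.mul hc.P_bdd.entrywiseMeasurable.inv).mul
    hc.B_bdd.entrywiseMeasurable.transpose

lemma hamiltonian_isBoundedMeasurable (hc : c.Admissible T) :
    IsBoundedMeasurable T c.hamiltonian := by
  refine ⟨fun i j => ?_, hc.hamiltonian_bdd⟩
  have hB := (hc.B_bdd.add hc.Bbar_bdd).entrywiseMeasurable.mul hc.invP_measurable
  have hR := hc.calR_bdd.entrywiseMeasurable.mul hc.invP_measurable
  rcases i with i | i <;> rcases j with j | j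
  · exact (hc.A_bdd.entrywiseMeasurable.add
      (hc.Abar_bdd.entrywiseMeasurable.sub (hB.mul hc.calS_bdd.1))) i j
  · exact (hB.mul hc.B_bdd.entrywiseMeasurable.transpose).neg i j
  · exact ((hc.Q_bdd.neg.sub hc.calQ_bdd).entrywiseMeasurable.add (hR.mul hc.calS_bdd.1)) i j
  · exact (hc.A_bdd.transpose.neg.entrywiseMeasurable.add
      (hR.mul hc.B_bdd.entrywiseMeasurable.transpose)) i j

/-- The inverse (P + 𝒫)⁻¹ need not be bounded, so this bound and the next three are read off the
blocks of 𝒜, whose boundedness is assumed. -/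
lemma driftPert_bdd (hc : c.Admissible T) : IsBoundedMeasurable T c.driftPert := by
  convert (hc.hamiltonian_isBoundedMeasurable.submatrix Sum.inl Sum.inl).sub hc.A_bdd using 2
  ext i j
  simp [hamiltonian]

lemma BB_bdd (hc : c.Admissible T) : IsBoundedMeasurable T c.BB := by
  convert (hc.hamiltonian_isBoundedMeasurable.submatrix Sum.inl Sum.inr).neg using 2
  ext i j
  simp [hamiltonian]

lemma RB_bdd (hc : c.Admissible T) : IsBoundedMeasurable T c.RB := by
  convert (hc.hamiltonian_isBoundedMeasurable.submatrix Sum.inr Sum.inr).add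
    hc.A_bdd.transpose using 2
  ext i j
  simp [hamiltonian]

lemma RS_bdd (hc : c.Admissible T) : IsBoundedMeasurable T c.RS := by
  convert (hc.hamiltonian_isBoundedMeasurable.submatrix Sum.inr Sum.inl).add
    (hc.Q_bdd.add hc.calQ_bdd) using 2
  ext i j
  simp only [hamiltonian, Matrix.add_apply, Matrix.submatrix_apply, Matrix.fromBlocks_apply₂₁,
    Matrix.sub_apply, Matrix.neg_apply]
  ring

lemma drift_bdd (hc : c.Admissible T) :
    IsBoundedMeasurable T (fun t => c.A t + c.driftPert t) := hc.A_bdd.add hc.driftPert_bdd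

lemma adjoint_bdd (hc : c.Admissible T) :
    IsBoundedMeasurable T (fun t => (c.A t)ᵀ - c.RB t) := hc.A_bdd.transpose.sub hc.RB_bdd

lemma source_bdd (hc : c.Admissible T) :
    IsBoundedMeasurable T (fun t => c.Q t + c.calQ t - c.RS t) :=
  (hc.Q_bdd.add hc.calQ_bdd).sub hc.RS_bdd

end Admissible

/-! ### Linearisation of the Riccati equation -/

/-- `(ξ, η)` solves the linear system `(ξ, η)' = 𝒜 (ξ, η)` on `[0,T]`. -/
def IsHamiltonianFlow (c : LQCoeff n m) (T : ℝ) (ξ η : ℝ → Fin n → ℝ) : Prop :=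
  IsVectorACDeriv T ξ (fun s => (c.A s + c.driftPert s) *ᵥ ξ s - c.BB s *ᵥ η s) ∧
    IsVectorACDeriv T η (fun s =>
      -((c.Q s + c.calQ s - c.RS s) *ᵥ ξ s + ((c.A s)ᵀ - c.RB s) *ᵥ η s))

lemma IsFBODESolution.isHamiltonianFlow (hT : 0 ≤ T) (hc : c.Admissible T) {x₀ : Fin n → ℝ}
    {ξ η : ℝ → Fin n → ℝ} (h : c.IsFBODESolution T x₀ ξ η) :
    c.IsHamiltonianFlow T ξ η ∧ η T = c.terminal T *ᵥ ξ T := by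
  obtain ⟨hξ, hη, h1, h2⟩ := h
  have hTm : T ∈ Icc 0 T := ⟨hT, le_rfl⟩
  have h0 : (0 : ℝ) ∈ Icc 0 T := ⟨le_rfl, hT⟩
  have hηT : η T = c.terminal T *ᵥ ξ T := by simpa using h2 T hTm
  have hξ0 : ξ 0 = x₀ := by simpa using h1 0 h0
  refine ⟨⟨.of_eq_add (fun i => ?_) h0 fun t ht => ?_,
    .of_eq_add (fun i => ?_) hTm fun t ht => ?_⟩, hηT⟩
  · exact (hc.drift_bdd.integrableOn_mulVec hξ i).sub (hc.BB_bdd.integrableOn_mulVec hη i)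
  · rw [hξ0]; exact h1 t ht
  · exact ((hc.source_bdd.integrableOn_mulVec hξ i).add
      (hc.adjoint_bdd.integrableOn_mulVec hη i)).neg
  · rw [hηT, intervalIntegral.integral_symm, intervalIntegral.integral_neg, neg_neg]
    exact h2 t ht

/-- A continuous `Γ` is bounded on [0,T], so the quadratic right-hand side is bounded measurable and
the integral equation can be differentiated entrywise. -/
lemma isRiccatiSolution_iff (hT : 0 ≤ T) (hc : c.Admissible T)
    {Γ : ℝ → Matrix (Fin n) (Fin n) ℝ} :
    c.IsRiccatiSolution T Γ ↔
      IsMatrixACDeriv T Γ (fun t => -c.riccatiRHS t (Γ t)) ∧ Γ T = c.terminal T := by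
  have hTm : T ∈ Icc 0 T := ⟨hT, le_rfl⟩
  constructor
  · rintro ⟨hΓ, h⟩
    have hΓT : Γ T = c.terminal T := by simpa using h T hTm
    have hΓb : IsBoundedMeasurable T Γ := .of_continuousOn fun i j =>
      continuousOn_pi.1 (continuousOn_pi.1 hΓ i) j
    refine ⟨.of_eq_add ?_ hTm fun t ht => ?_, hΓT⟩
    · exact ((((hΓb.mul hc.drift_bdd).add (hc.adjoint_bdd.mul hΓb)).sub
        ((hΓb.mul hc.BB_bdd).mul hΓb)).add hc.source_bdd).neg
    · rw [hΓT, intervalIntegral.integral_symm, intervalIntegral.integral_neg, neg_neg]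
      exact h t ht
  · rintro ⟨hΓ, hΓT⟩
    refine ⟨hΓ.continuousOn, fun t ht => ?_⟩
    have h := hΓ.eq_add_integral hTm ht
    rwa [hΓT, intervalIntegral.integral_symm, intervalIntegral.integral_neg, neg_neg] at h

/-- The blocks of `(Q_T + 𝒬_T, -I) Φ(T,t)` satisfy the adjoint Hamiltonian system. -/
lemma isMatrixACDeriv_blocks {X Y : ℝ → Matrix (Fin n ⊕ Fin n) (Fin n ⊕ Fin n) ℝ}
    (hY : IsMatrixACDeriv T Y (fun t => -(Y t * c.hamiltonian t))) :
    IsMatrixACDeriv T (c.upperBlock T fun t s => X t * Y s)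
        (fun t => -(c.upperBlock T (fun t s => X t * Y s) t * (c.A t + c.driftPert t) -
          c.lowerBlock T (fun t s => X t * Y s) t * (c.Q t + c.calQ t - c.RS t))) ∧
      IsMatrixACDeriv T (c.lowerBlock T fun t s => X t * Y s)
        (fun t => c.upperBlock T (fun t s => X t * Y s) t * c.BB t +
          c.lowerBlock T (fun t s => X t * Y s) t * ((c.A t)ᵀ - c.RB t)) := by
  -- In Φ(T,t) = X_T Y_t only Y_t varies, and Y' = -Y𝒜; the two identities below are the block
  -- columns of 𝒜.
  have hW := hY.const_mul ((Matrix.fromCols (c.terminal T) (-1) :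
    Matrix (Fin n) (Fin n ⊕ Fin n) ℝ) * X T)
  have e1 : ∀ t, c.hamiltonian t * (Matrix.fromRows 1 0 : Matrix (Fin n ⊕ Fin n) (Fin n) ℝ) =
      (Matrix.fromRows 1 0 : Matrix (Fin n ⊕ Fin n) (Fin n) ℝ) * (c.A t + c.driftPert t) -
      (Matrix.fromRows 0 1 : Matrix (Fin n ⊕ Fin n) (Fin n) ℝ) *
        (c.Q t + c.calQ t - c.RS t) := by
    intro t
    rw [hamiltonian, Matrix.fromBlocks_mul_fromRows, Matrix.fromRows_mul, Matrix.fromRows_mul]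
    ext (i | i) j <;> simp
    ring
  have e2 : ∀ t, c.hamiltonian t * (Matrix.fromRows 0 1 : Matrix (Fin n ⊕ Fin n) (Fin n) ℝ) =
      -((Matrix.fromRows 1 0 : Matrix (Fin n ⊕ Fin n) (Fin n) ℝ) * c.BB t +
      (Matrix.fromRows 0 1 : Matrix (Fin n ⊕ Fin n) (Fin n) ℝ) * ((c.A t)ᵀ - c.RB t)) := by
    intro t
    rw [hamiltonian, Matrix.fromBlocks_mul_fromRows, Matrix.fromRows_mul, Matrix.fromRows_mul]
    ext (i | i) j <;> simp [neg_add_eq_sub]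
  constructor
  · refine (hW.mul_const (Matrix.fromRows 1 0)).congr
      (fun t _ => by simp only [upperBlock, Matrix.mul_assoc]) fun t _ => ?_
    simp only [upperBlock, lowerBlock, Matrix.mul_neg, Matrix.neg_mul, Matrix.mul_assoc, e1,
      Matrix.mul_sub]
  · refine (hW.mul_const (Matrix.fromRows 0 1)).congr
      (fun t _ => by simp only [lowerBlock, Matrix.mul_assoc]) fun t _ => ?_
    simp only [upperBlock, lowerBlock, Matrix.mul_neg, Matrix.neg_mul, Matrix.mul_assoc, e2,
      Matrix.mul_add, neg_neg]

lemma blocks_terminal {Φ : ℝ → ℝ → Matrix (Fin n ⊕ Fin n) (Fin n ⊕ Fin n) ℝ} (h : Φ T T = 1) :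
    c.upperBlock T Φ T = c.terminal T ∧ c.lowerBlock T Φ T = -1 := by
  constructor <;> simp [upperBlock, lowerBlock, h, Matrix.fromCols_mul_fromRows]

/-- `U ξ + L η` is constant along the flow. -/
lemma IsHamiltonianFlow.blocks_mulVec_eq {ξ η : ℝ → Fin n → ℝ} (h : c.IsHamiltonianFlow T ξ η)
    {U L : ℝ → Matrix (Fin n) (Fin n) ℝ}
    (hU : IsMatrixACDeriv T U (fun t => -(U t * (c.A t + c.driftPert t) -
      L t * (c.Q t + c.calQ t - c.RS t))))
    (hL : IsMatrixACDeriv T L (fun t => U t * c.BB t + L t * ((c.A t)ᵀ - c.RB t)))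
    {s t : ℝ} (hs : s ∈ Icc 0 T) (ht : t ∈ Icc 0 T) :
    U s *ᵥ ξ s + L s *ᵥ η s = U t *ᵥ ξ t + L t *ᵥ η t := by
  refine ((IsVectorACDeriv.mulVec hU h.1).add (IsVectorACDeriv.mulVec hL h.2)).eq_of_deriv_eq_zero
    (fun t _ => ?_) hs ht
  generalize c.A t + c.driftPert t = a, c.Q t + c.calQ t - c.RS t = b, (c.A t)ᵀ - c.RB t = d
  simp only [Matrix.mulVec_sub, Matrix.mulVec_neg, Matrix.neg_mulVec, Matrix.mulVec_add,
    Matrix.mulVec_mulVec, Matrix.sub_mulVec, Matrix.add_mulVec]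
  abel

/-- `Γ = -L⁻¹ U` solves the Riccati equation. -/
lemma isMatrixACDeriv_riccati (hT : 0 ≤ T) (hc : c.Admissible T)
    {U L : ℝ → Matrix (Fin n) (Fin n) ℝ}
    (hU : IsMatrixACDeriv T U (fun t => -(U t * (c.A t + c.driftPert t) -
      L t * (c.Q t + c.calQ t - c.RS t))))
    (hL : IsMatrixACDeriv T L (fun t => U t * c.BB t + L t * ((c.A t)ᵀ - c.RB t)))
    (hu : ∀ t ∈ Icc 0 T, IsUnit (L t)) :
    IsMatrixACDeriv T (fun t => -((L t)⁻¹ * U t))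
      (fun t => -c.riccatiRHS t (-((L t)⁻¹ * U t))) := by
  have hTm : T ∈ Icc 0 T := ⟨hT, le_rfl⟩
  have hdet : ∀ t ∈ Icc 0 T, IsUnit (L t).det := fun t ht =>
    (Matrix.isUnit_iff_isUnit_det _).1 (hu t ht)
  have hLinv : IsBoundedMeasurable T (fun t => (L t)⁻¹) := by
    refine .of_continuousOn fun i j => ?_
    have : ContinuousOn (fun t => (L t)⁻¹) (Icc 0 T) := by
      simp only [Matrix.inv_def, Ring.inverse_eq_inv']
      refine ContinuousOn.smul (ContinuousOn.inv₀ ?_ fun t ht => (hdet t ht).ne_zero) ?_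
      · exact continuous_id.matrix_det.comp_continuousOn hL.continuousOn
      · exact continuous_id.matrix_adjugate.comp_continuousOn hL.continuousOn
    exact continuousOn_pi.1 (continuousOn_pi.1 this i) j
  -- `K` is chosen so that L' = LK. With X' = -KX the product LX is constant, hence L⁻¹ is X times a
  -- constant matrix. This gives absolute continuity and the derivative of L⁻¹ together.
  set K : ℝ → Matrix (Fin n) (Fin n) ℝ := fun t => (L t)⁻¹ * U t * c.BB t + ((c.A t)ᵀ - c.RB t)
    with hK
  have hKb : IsBoundedMeasurable T K :=
    ((hLinv.mul hU.isBoundedMeasurable).mul hc.BB_bdd).add hc.adjoint_bdd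
  have hLK : ∀ t ∈ Icc 0 T, L t * K t = U t * c.BB t + L t * ((c.A t)ᵀ - c.RB t) := by
    intro t ht
    simp only [hK, Matrix.mul_add, ← Matrix.mul_assoc, Matrix.mul_nonsing_inv _ (hdet t ht),
      Matrix.one_mul]
  obtain ⟨X, Y, hX, hY, hXY⟩ := hKb.neg.exists_isMatrixACDeriv_inverse hT
  have hconst : ∀ t ∈ Icc 0 T, L t * X t = L T * X T := fun t ht =>
    (hL.mul hX).eq_of_deriv_eq_zero (fun t ht => by
      rw [← hLK t ht]; simp [mul_assoc]) ht hTm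
  have hXT : IsUnit (L T * X T).det := by
    rw [Matrix.det_mul]
    exact (hdet T hTm).mul (Matrix.isUnit_det_of_right_inverse (hXY T hTm).1)
  have hinv : ∀ t ∈ Icc 0 T, X t * (L T * X T)⁻¹ = (L t)⁻¹ := by
    intro t ht
    refine (Matrix.inv_eq_right_inv ?_).symm
    rw [← Matrix.mul_assoc, hconst t ht, Matrix.mul_nonsing_inv _ hXT]
  have hLi : IsMatrixACDeriv T (fun t => (L t)⁻¹) (fun t => -(K t * (L t)⁻¹)) :=
    (hX.mul_const (L T * X T)⁻¹).congr hinv fun t ht => by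
      rw [← hinv t ht]; simp [mul_assoc]
  refine (hLi.mul hU).neg.congr_deriv fun t ht => ?_
  have h1 : (L t)⁻¹ * (L t * (c.Q t + c.calQ t - c.RS t)) = c.Q t + c.calQ t - c.RS t := by
    rw [← Matrix.mul_assoc, Matrix.nonsing_inv_mul _ (hdet t ht), Matrix.one_mul]
  simp only [riccatiRHS, Matrix.mul_neg, Matrix.mul_sub (L t)⁻¹ (U t * _), h1, hK]
  noncomm_ring

/-- Uniqueness for the Riccati equation: every solution satisfies `U + L Γ = 0`. -/
lemma upper_add_lower_mul_eq_zero (hT : 0 ≤ T) (hc : c.Admissible T)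
    {U L Γ : ℝ → Matrix (Fin n) (Fin n) ℝ}
    (hU : IsMatrixACDeriv T U (fun t => -(U t * (c.A t + c.driftPert t) -
      L t * (c.Q t + c.calQ t - c.RS t))))
    (hL : IsMatrixACDeriv T L (fun t => U t * c.BB t + L t * ((c.A t)ᵀ - c.RB t)))
    (hΓ : IsMatrixACDeriv T Γ (fun t => -c.riccatiRHS t (Γ t)))
    (hend : U T + L T * Γ T = 0) {t : ℝ} (ht : t ∈ Icc 0 T) : U t + L t * Γ t = 0 := by
  have hTm : T ∈ Icc 0 T := ⟨hT, le_rfl⟩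
  -- D = U + LΓ satisfies D' = -D(A + `driftPert` - `BB`Γ): the terms quadratic in Γ regroup into D.
  -- With X solving the matching linear equation, DX is constant, and it is zero at T.
  obtain ⟨X, Y, hX, hY, hXY⟩ := (hc.drift_bdd.sub
    (hc.BB_bdd.mul hΓ.isBoundedMeasurable)).exists_isMatrixACDeriv_inverse hT
  have h := ((hU.add (hL.mul hΓ)).mul hX).eq_of_deriv_eq_zero (fun t _ => by
    simp only [riccatiRHS]; noncomm_ring) ht hTm
  simp only [hend, Matrix.zero_mul] at h
  have h2 := congrArg (· * Y t) h
  simpa [Matrix.mul_assoc, (hXY t ht).1] using h2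

/-- If the forward-backward system has only the trivial solution on every `[t₀,T]`, then
`(Q_T + 𝒬_T, -I) Φ(T,t) (0; I)` is invertible. -/
lemma isUnit_lowerBlock (huniq : ∀ ξ η t₀, t₀ ∈ Icc 0 T →
      c.IsHamiltonianFlow T ξ η → ξ t₀ = 0 → η T = c.terminal T *ᵥ ξ T → η t₀ = 0)
    {X Y : ℝ → Matrix (Fin n ⊕ Fin n) (Fin n ⊕ Fin n) ℝ}
    (hX : IsMatrixACDeriv T X (fun t => c.hamiltonian t * X t))
    (hXY : ∀ t ∈ Icc 0 T, X t * Y t = 1) {t : ℝ} (ht : t ∈ Icc 0 T) :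
    IsUnit (c.lowerBlock T (fun t s => X t * Y s) t) := by
  rw [← Matrix.mulVec_injective_iff_isUnit]
  refine (injective_iff_map_eq_zero (Matrix.mulVecLin
    (c.lowerBlock T (fun t s => X t * Y s) t))).2 fun y hy => ?_
  rw [Matrix.mulVecLin_apply] at hy
  -- For y in the kernel, `w` is the flow that passes through (0, y) at time `t`; L_t y = 0 becomes
  -- its terminal condition.
  set z : Fin n ⊕ Fin n → ℝ := (Matrix.fromRows 0 1 : Matrix (Fin n ⊕ Fin n) (Fin n) ℝ) *ᵥ y
    with hz
  have hflow := IsVectorACDeriv.mulVec_const (hX.mul_const (Y t)) z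
  set w : ℝ → Fin n ⊕ Fin n → ℝ := fun s => (X s * Y t) *ᵥ z with hw
  have hwt : w t = z := by simp [hw, hXY t ht]
  have hz' : z = Sum.elim (0 : Fin n → ℝ) y := by
    ext (i | i) <;> simp [hz, Matrix.fromRows_mulVec]
  have hham : ∀ s, (c.hamiltonian s * X s * Y t) *ᵥ z = c.hamiltonian s *ᵥ w s := by
    intro s
    simp [hw, Matrix.mulVec_mulVec, Matrix.mul_assoc]
  have hblock : ∀ s, c.hamiltonian s *ᵥ w s = Sum.elim
      ((c.A s + c.driftPert s) *ᵥ (w s ∘ Sum.inl) - c.BB s *ᵥ (w s ∘ Sum.inr))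
      (-((c.Q s + c.calQ s - c.RS s) *ᵥ (w s ∘ Sum.inl) +
        ((c.A s)ᵀ - c.RB s) *ᵥ (w s ∘ Sum.inr))) := by
    intro s
    rw [hamiltonian, Matrix.fromBlocks_mulVec]
    congr 1
    · rw [Matrix.neg_mulVec, sub_eq_add_neg]
    · rw [neg_add, ← Matrix.neg_mulVec, ← Matrix.neg_mulVec]
      congr 2 <;> abel
  have h := huniq (fun s => w s ∘ Sum.inl) (fun s => w s ∘ Sum.inr) t ht ⟨fun i => ?_, fun i => ?_⟩
    ?_ ?_
  · simpa [hwt, hz'] using h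
  · exact (hflow (Sum.inl i)).congr (fun _ _ => rfl) fun s _ => by
      change ((c.hamiltonian s * X s * Y t) *ᵥ z) _ = _
      rw [hham, hblock]; rfl
  · exact (hflow (Sum.inr i)).congr (fun _ _ => rfl) fun s _ => by
      change ((c.hamiltonian s * X s * Y t) *ᵥ z) _ = _
      rw [hham, hblock]; rfl
  · simp [hwt, hz']
  · have h1 : (Matrix.fromCols (c.terminal T) (-1) : Matrix (Fin n) (Fin n ⊕ Fin n) ℝ) *ᵥ w T
        = 0 := by
      rw [← hy]
      simp only [hw, hz, Matrix.mulVec_mulVec, lowerBlock, Matrix.mul_assoc]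
    rw [← Sum.elim_comp_inl_inr (w T), Matrix.fromCols_mulVec_sumElim, Matrix.neg_mulVec,
      Matrix.one_mulVec, ← sub_eq_add_neg, sub_eq_zero] at h1
    exact h1.symm

/-- Solvability of the Riccati equation from uniqueness for the forward-backward systems. -/
theorem riccati_of_unique (hT : 0 ≤ T) (hc : c.Admissible T)
    (huniq : ∀ ξ η t₀, t₀ ∈ Icc 0 T →
      c.IsHamiltonianFlow T ξ η → ξ t₀ = 0 → η T = c.terminal T *ᵥ ξ T → η t₀ = 0) :
    (∃ Φ, IsFundamentalSolution T c.hamiltonian Φ) ∧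
    ∃ Γ : ℝ → Matrix (Fin n) (Fin n) ℝ,
      c.IsRiccatiSolution T Γ ∧
      (∀ Γ' : ℝ → Matrix (Fin n) (Fin n) ℝ, c.IsRiccatiSolution T Γ' →
        ∀ t ∈ Set.Icc 0 T, Γ' t = Γ t) ∧
      (∀ Φ, IsFundamentalSolution T c.hamiltonian Φ → ∀ t ∈ Set.Icc 0 T,
        IsUnit (c.lowerBlock T Φ t) ∧
        Γ t = -((c.lowerBlock T Φ t)⁻¹ * c.upperBlock T Φ t)) ∧
      (∀ (x₀ : Fin n → ℝ) (ξ η : ℝ → Fin n → ℝ), c.IsFBODESolution T x₀ ξ η →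
        ∀ t ∈ Set.Icc 0 T, η t = (Γ t).mulVec (ξ t)) := by
  have hTm : T ∈ Icc 0 T := ⟨hT, le_rfl⟩
  have hH := hc.hamiltonian_isBoundedMeasurable
  obtain ⟨X, Y, hX, hY, hXY⟩ := hH.exists_isMatrixACDeriv_inverse hT
  have hfund := IsFundamentalSolution.of_isMatrixACDeriv hX fun t ht => (hXY t ht).1
  obtain ⟨hU, hL⟩ := isMatrixACDeriv_blocks (c := c) (X := X) hY
  have hu := fun t ht => isUnit_lowerBlock huniq hX (fun t ht => (hXY t ht).1) (t := t) ht
  obtain ⟨hUT, hLT⟩ := blocks_terminal (c := c) (Φ := fun t s => X t * Y s) (hfund.apply_self hTm)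
  set U := c.upperBlock T fun t s => X t * Y s with hUdef
  set L := c.lowerBlock T fun t s => X t * Y s with hLdef
  have hsolve : ∀ t ∈ Icc 0 T, (L t)⁻¹ * L t = 1 := fun t ht =>
    Matrix.nonsing_inv_mul _ ((Matrix.isUnit_iff_isUnit_det _).1 (hu t ht))
  have hΓT : -((L T)⁻¹ * U T) = c.terminal T := by
    rw [hLT, hUT, Matrix.inv_eq_right_inv (B := -1) (by simp)]
    simp
  refine ⟨⟨_, hfund⟩, fun t => -((L t)⁻¹ * U t),
    (isRiccatiSolution_iff hT hc).2 ⟨isMatrixACDeriv_riccati hT hc hU hL hu, hΓT⟩,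
    fun Γ' hΓ' t ht => ?_, fun Φ hΦ t ht => ?_, fun x₀ ξ η h t ht => ?_⟩
  · obtain ⟨h1, h2⟩ := (isRiccatiSolution_iff hT hc).1 hΓ'
    have h3 := upper_add_lower_mul_eq_zero hT hc hU hL h1 (by rw [hUT, hLT, h2]; simp) ht
    have h4 := congrArg ((L t)⁻¹ * ·) h3
    simp only [Matrix.mul_add, ← Matrix.mul_assoc, hsolve t ht, Matrix.one_mul,
      Matrix.mul_zero] at h4
    exact eq_neg_of_add_eq_zero_right h4
  · have hΦe : Φ T t = X T * Y t := hΦ.eq_mul hH hY (fun t ht => (hXY t ht).1) ht hTm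
    have e1 : c.lowerBlock T Φ t = L t := by simp only [lowerBlock, hLdef, hΦe]
    have e2 : c.upperBlock T Φ t = U t := by simp only [upperBlock, hUdef, hΦe]
    rw [e1, e2]
    exact ⟨hu t ht, rfl⟩
  · obtain ⟨h1, h2⟩ := h.isHamiltonianFlow hT hc
    have h3 := h1.blocks_mulVec_eq hU hL ht hTm
    rw [hUT, hLT, h2, Matrix.neg_mulVec, Matrix.one_mulVec, add_neg_cancel] at h3
    have h4 := congrArg ((L t)⁻¹ *ᵥ ·) h3
    simp only [Matrix.mulVec_add, Matrix.mulVec_mulVec, hsolve t ht, Matrix.one_mulVec,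
      Matrix.mulVec_zero] at h4
    rw [Matrix.neg_mulVec]
    exact eq_neg_of_add_eq_zero_right h4

end LQCoeff

/-! ### Euclidean norms and matrix square roots -/

section EuclideanNorm

variable {ι κ : Type*} [Fintype ι] [Fintype κ]

/-- The Euclidean norm of a real vector. -/
noncomputable def l2norm (x : ι → ℝ) : ℝ := ‖WithLp.toLp 2 x‖

lemma l2norm_nonneg (x : ι → ℝ) : 0 ≤ l2norm x := norm_nonneg _

lemma l2norm_sq (x : ι → ℝ) : l2norm x ^ 2 = x ⬝ᵥ x := by
  rw [l2norm, EuclideanSpace.real_norm_sq_eq]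
  simp [dotProduct, sq]

lemma l2norm_eq_zero {x : ι → ℝ} : l2norm x = 0 ↔ x = 0 := by
  simp [l2norm]

lemma abs_dotProduct_le (x y : ι → ℝ) : |x ⬝ᵥ y| ≤ l2norm x * l2norm y := by
  have := abs_real_inner_le_norm (WithLp.toLp 2 y) (WithLp.toLp 2 x)
  rwa [EuclideanSpace.inner_toLp_toLp, star_trivial, mul_comm] at this

lemma l2norm_mulVec_le [DecidableEq κ] (M : Matrix ι κ ℝ) (x : κ → ℝ) :
    l2norm (M *ᵥ x) ≤ ‖M‖ * l2norm x :=
  Matrix.l2_opNorm_mulVec M (WithLp.toLp 2 x)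

lemma continuous_l2norm : Continuous (l2norm : (ι → ℝ) → ℝ) :=
  (PiLp.continuous_toLp 2 _).norm

lemma l2_opNorm_transpose [DecidableEq ι] [DecidableEq κ] (M : Matrix ι κ ℝ) : ‖Mᵀ‖ = ‖M‖ := by
  rw [← Matrix.conjTranspose_eq_transpose_of_trivial, Matrix.l2_opNorm_conjTranspose]

lemma dotProduct_mulVec_comm (x : ι → ℝ) (M : Matrix ι κ ℝ) (y : κ → ℝ) :
    x ⬝ᵥ M *ᵥ y = (Mᵀ *ᵥ x) ⬝ᵥ y := by
  rw [Matrix.dotProduct_mulVec, ← Matrix.vecMul_transpose, Matrix.transpose_transpose]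

variable [DecidableEq ι]

/-- A bilinear form is bounded by the weighted operator norm of its matrix. -/
lemma abs_dotProduct_mulVec_le_weighted {p q K : Matrix ι ι ℝ} (hp : IsUnit p) (hq : IsUnit q)
    (hpT : pᵀ = p) (x y : ι → ℝ) :
    |x ⬝ᵥ K *ᵥ y| ≤ ‖p⁻¹ * K * q⁻¹‖ * (l2norm (p *ᵥ x) * l2norm (q *ᵥ y)) := by
  have hp' := (Matrix.isUnit_iff_isUnit_det _).1 hp
  have hq' := (Matrix.isUnit_iff_isUnit_det _).1 hq
  have h : x ⬝ᵥ K *ᵥ y = (p *ᵥ x) ⬝ᵥ (p⁻¹ * K * q⁻¹) *ᵥ (q *ᵥ y) := by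
    conv_rhs => rw [← hpT, ← dotProduct_mulVec_comm, Matrix.mulVec_mulVec, Matrix.mulVec_mulVec,
      hpT]
    rw [Matrix.mul_assoc p⁻¹, Matrix.mul_nonsing_inv_cancel_left _ _ hp',
      Matrix.nonsing_inv_mul_cancel_right _ _ hq']
  rw [h]
  refine (abs_dotProduct_le _ _).trans ?_
  calc _ ≤ l2norm (p *ᵥ x) * (‖p⁻¹ * K * q⁻¹‖ * l2norm (q *ᵥ y)) :=
        mul_le_mul_of_nonneg_left (l2norm_mulVec_le _ _) (l2norm_nonneg _)
    _ = _ := by ring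

lemma Matrix.transpose_cfcSqrt (A : Matrix ι ι ℝ) :
    (CFC.sqrt A)ᵀ = CFC.sqrt A := by
  rw [← Matrix.conjTranspose_eq_transpose_of_trivial]
  exact (Matrix.nonneg_iff_posSemidef.1 (CFC.sqrt_nonneg A)).isHermitian

lemma Matrix.PosSemidef.isUnit_sqrt {A : Matrix ι ι ℝ} (hA : A.PosSemidef) (hu : IsUnit A) :
    IsUnit (CFC.sqrt A) := by
  have h := CFC.sqrt_mul_sqrt_self A hA.nonneg
  rw [← h, ← sq] at hu
  exact (isUnit_pow_iff two_ne_zero).1 hu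

lemma Matrix.PosSemidef.dotProduct_mulVec_eq_sqrt {A : Matrix ι ι ℝ} (hA : A.PosSemidef)
    (x : ι → ℝ) : x ⬝ᵥ A *ᵥ x = l2norm (CFC.sqrt A *ᵥ x) ^ 2 := by
  conv_lhs => rw [← CFC.sqrt_mul_sqrt_self A hA.nonneg, ← Matrix.mulVec_mulVec,
    dotProduct_mulVec_comm, Matrix.transpose_cfcSqrt]
  rw [l2norm_sq]

end EuclideanNorm

/-! ### Extreme eigenvalues and singular values -/

section Eigenvalues

variable {n : ℕ}

lemma lambdaMin_mul_le {M : Matrix (Fin n) (Fin n) ℝ} (hM : M.IsHermitian) (x : Fin n → ℝ) :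
    lambdaMin M * l2norm x ^ 2 ≤ x ⬝ᵥ M *ᵥ x := by
  have h : algebraMap ℝ _ (lambdaMin M) ≤ M := algebraMap_le_of_le_spectrum
    (fun r hr => csInf_le Matrix.finite_real_spectrum.bddBelow hr) (ha := hM.isSelfAdjoint)
  have h1 := (Matrix.le_iff.1 h).dotProduct_mulVec_nonneg x
  rw [star_trivial, Matrix.sub_mulVec, dotProduct_sub, Algebra.algebraMap_eq_smul_one,
    Matrix.smul_mulVec, Matrix.one_mulVec, dotProduct_smul, ← l2norm_sq, smul_eq_mul] at h1
  linarith

lemma le_lambdaMax_mul {M : Matrix (Fin n) (Fin n) ℝ} (hM : M.IsHermitian) (x : Fin n → ℝ) :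
    x ⬝ᵥ M *ᵥ x ≤ lambdaMax M * l2norm x ^ 2 := by
  have h : M ≤ algebraMap ℝ _ (lambdaMax M) := le_algebraMap_of_spectrum_le
    (fun r hr => le_csSup Matrix.finite_real_spectrum.bddAbove hr) (ha := hM.isSelfAdjoint)
  have h1 := (Matrix.le_iff.1 h).dotProduct_mulVec_nonneg x
  rw [star_trivial, Matrix.sub_mulVec, dotProduct_sub, Algebra.algebraMap_eq_smul_one,
    Matrix.smul_mulVec, Matrix.one_mulVec, dotProduct_smul, ← l2norm_sq, smul_eq_mul] at h1
  linarith

/-- The factor ‖1‖ equals 1 except for n = 0, where the spectrum is empty, its supremum is 0 by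
default, and ‖1‖ = 0. -/
lemma lambdaMax_le_norm (M : Matrix (Fin n) (Fin n) ℝ) :
    lambdaMax M ≤ ‖M‖ * ‖(1 : Matrix (Fin n) (Fin n) ℝ)‖ :=
  Real.sSup_le (fun r hr => (le_abs_self r).trans (spectrum.norm_le_norm_mul_of_mem hr))
    (by positivity)

lemma sigmaMax_nonneg (M : Matrix (Fin n) (Fin n) ℝ) : 0 ≤ sigmaMax M := Real.sqrt_nonneg _

lemma l2norm_mulVec_le_sigmaMax (M : Matrix (Fin n) (Fin n) ℝ) (x : Fin n → ℝ) :
    l2norm (M *ᵥ x) ≤ sigmaMax M * l2norm x := by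
  refine le_of_sq_le_sq ?_ (mul_nonneg (sigmaMax_nonneg M) (l2norm_nonneg x))
  have hM : (Mᵀ * M).IsHermitian := by
    simpa using Matrix.isHermitian_conjTranspose_mul_self M
  have h := le_lambdaMax_mul hM x
  rw [← Matrix.mulVec_mulVec, dotProduct_mulVec_comm, Matrix.transpose_transpose,
    ← l2norm_sq] at h
  rw [mul_pow]
  refine h.trans (mul_le_mul_of_nonneg_right ?_ (sq_nonneg _))
  -- The square of the real root is max(λ, 0), so the sign of the largest eigenvalue need not be
  -- known.
  rw [sigmaMax, Real.sq_sqrt']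
  exact le_max_left _ _

lemma sigmaMax_sq_le (M : Matrix (Fin n) (Fin n) ℝ) :
    sigmaMax M ^ 2 ≤ ‖M‖ ^ 2 * ‖(1 : Matrix (Fin n) (Fin n) ℝ)‖ := by
  rw [sigmaMax, Real.sq_sqrt']
  refine max_le ((lambdaMax_le_norm _).trans ?_) (by positivity)
  refine mul_le_mul_of_nonneg_right ?_ (norm_nonneg _)
  refine (norm_mul_le _ _).trans ?_
  rw [l2_opNorm_transpose, sq]

lemma isHermitian_symPart (M : Matrix (Fin n) (Fin n) ℝ) : (symPart M).IsHermitian := by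
  ext i j
  simp [symPart]
  ring

lemma dotProduct_symPart_mulVec (M : Matrix (Fin n) (Fin n) ℝ) (x : Fin n → ℝ) :
    x ⬝ᵥ symPart M *ᵥ x = x ⬝ᵥ M *ᵥ x := by
  have h : x ⬝ᵥ Mᵀ *ᵥ x = x ⬝ᵥ M *ᵥ x := by
    rw [dotProduct_mulVec_comm, Matrix.transpose_transpose, dotProduct_comm]
  rw [symPart, Matrix.smul_mulVec, Matrix.add_mulVec, dotProduct_smul, dotProduct_add, h,
    smul_eq_mul]
  ring

lemma norm_symPart_le (M : Matrix (Fin n) (Fin n) ℝ) : ‖symPart M‖ ≤ ‖M‖ := by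
  rw [symPart, norm_smul]
  have := norm_add_le M Mᵀ
  rw [l2_opNorm_transpose] at this
  norm_num
  linarith

end Eigenvalues

/-! ### The energy identity and the monotone case -/

/-- A continuous function on `[a,b]` that vanishes wherever a non-positive integrand with
non-negative integral vanishes is zero at `a`. -/
lemma eq_zero_of_integral_nonneg {E : Type*} [NormedAddCommGroup E] {e : ℝ → ℝ} {η : ℝ → E}
    {a b : ℝ} (hab : a < b) (he : IntervalIntegrable e volume a b)
    (h : ∀ s ∈ Icc a b, e s ≤ 0 ∧ (e s = 0 → η s = 0)) (h0 : 0 ≤ ∫ s in a..b, e s)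
    (hη : ContinuousOn η (Icc a b)) : η a = 0 := by
  have hnn : 0 ≤ᵐ[volume.restrict (Ioc a b)] fun s => -e s :=
    (ae_restrict_iff' measurableSet_Ioc).2 (.of_forall fun s hs => by
      simpa using (h s (Ioc_subset_Icc_self hs)).1)
  have hi : ∫ s in a..b, -e s = 0 := by
    refine le_antisymm ?_ (intervalIntegral.integral_nonneg hab.le fun s hs => by
      simpa using (h s hs).1)
    rw [intervalIntegral.integral_neg]
    linarith
  have hz := (intervalIntegral.integral_eq_zero_iff_of_le_of_nonneg_ae hab.le hnn he.neg).1 hi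
  have hη0 : η =ᵐ[volume.restrict (Icc a b)] fun _ => (0 : E) := by
    rw [← restrict_Ioc_eq_restrict_Icc]
    filter_upwards [hz, ae_restrict_mem measurableSet_Ioc] with s hs hsI
    exact (h s (Ioc_subset_Icc_self hsI)).2 (by simpa using hs)
  exact Measure.eqOn_Icc_of_ae_eq volume hab.ne hη0 hη continuousOn_const ⟨le_rfl, hab.le⟩

namespace LQCoeff

variable {n m : ℕ} {c : LQCoeff n m} {T : ℝ}

/-- The derivative of `ξ · η` along the flow, as a quadratic form in `(ξ, η)`. -/
noncomputable def energyRate (c : LQCoeff n m) (t : ℝ) (x y : Fin n → ℝ) : ℝ :=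
  -(x ⬝ᵥ c.Q t *ᵥ x) - x ⬝ᵥ c.calQ t *ᵥ x + x ⬝ᵥ c.RS t *ᵥ x + x ⬝ᵥ c.RB t *ᵥ y +
    y ⬝ᵥ c.driftPert t *ᵥ x - y ⬝ᵥ c.BB t *ᵥ y

/-- A acts on ξ and -Aᵀ on η, so the two contributions cancel. This is why no size of A enters the
energy rate. -/
lemma IsHamiltonianFlow.isACDeriv_dotProduct {ξ η : ℝ → Fin n → ℝ}
    (h : c.IsHamiltonianFlow T ξ η) :
    IsACDeriv T (fun t => ξ t ⬝ᵥ η t) (fun t => c.energyRate t (ξ t) (η t)) := by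
  refine (h.1.dotProduct h.2).congr (fun _ _ => rfl) fun t _ => ?_
  have h1 : (c.A t *ᵥ ξ t) ⬝ᵥ η t = ξ t ⬝ᵥ (c.A t)ᵀ *ᵥ η t := by
    rw [dotProduct_mulVec_comm, Matrix.transpose_transpose]
  simp only [energyRate, Matrix.add_mulVec, Matrix.sub_mulVec, add_dotProduct, sub_dotProduct,
    dotProduct_neg, dotProduct_add, dotProduct_sub, h1]
  rw [dotProduct_comm (c.driftPert t *ᵥ ξ t), dotProduct_comm (c.BB t *ᵥ η t)]
  ring

/-- Uniqueness for the forward-backward system from definiteness of the energy rate. -/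
lemma IsHamiltonianFlow.eq_zero_of_energyRate {ξ η : ℝ → Fin n → ℝ} {t₀ : ℝ}
    (h : c.IsHamiltonianFlow T ξ η) (ht₀ : t₀ ∈ Icc 0 T) (h0 : ξ t₀ = 0)
    (hT : η T = c.terminal T *ᵥ ξ T) (hterm : ∀ x, 0 ≤ x ⬝ᵥ c.terminal T *ᵥ x)
    (hrate : ∀ t ∈ Icc 0 T, ∀ x y, c.energyRate t x y ≤ 0 ∧ (c.energyRate t x y = 0 → y = 0)) :
    η t₀ = 0 := by
  rcases ht₀.2.eq_or_lt with rfl | hlt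
  · rw [hT, h0, Matrix.mulVec_zero]
  have hTm : T ∈ Icc 0 T := ⟨ht₀.1.trans ht₀.2, le_rfl⟩
  have hac := h.isACDeriv_dotProduct
  refine eq_zero_of_integral_nonneg hlt (hac.intervalIntegrable ht₀ hTm)
    (fun s hs => hrate s ⟨ht₀.1.trans hs.1, hs.2⟩ _ _) ?_
    (h.2.continuousOn.mono (Icc_subset_Icc_left ht₀.1))
  rw [hac.integral_eq_sub ht₀ hTm, h0, zero_dotProduct, sub_zero, hT]
  exact hterm _

section Monotone

lemma K1_mul_le (h : 0 < c.K1 T) {t : ℝ} (ht : t ∈ Icc 0 T) (x : Fin n → ℝ) :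
    c.K1 T * l2norm x ^ 2 ≤ x ⬝ᵥ (c.Q t + c.calQ t) *ᵥ x := by
  rw [← dotProduct_symPart_mulVec]
  refine le_trans (mul_le_mul_of_nonneg_right ?_ (sq_nonneg _))
    (lambdaMin_mul_le (isHermitian_symPart _) x)
  -- A real infimum over a set unbounded below is 0 by default, so positivity of `K1` rules that
  -- case out. The same device serves for `K2`.
  by_cases hb : BddBelow (range fun t : Icc (0 : ℝ) T => lambdaMin (symPart (c.Q t + c.calQ t)))
  · exact ciInf_le hb ⟨t, ht⟩
  · exact absurd (Real.iInf_of_not_bddBelow hb) h.ne'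

lemma K2_mul_le (h : 0 < c.K2 T) {t : ℝ} (ht : t ∈ Icc 0 T) (x : Fin n → ℝ) :
    c.K2 T * l2norm x ^ 2 ≤ x ⬝ᵥ c.BB t *ᵥ x := by
  rw [← dotProduct_symPart_mulVec]
  refine le_trans (mul_le_mul_of_nonneg_right ?_ (sq_nonneg _))
    (lambdaMin_mul_le (isHermitian_symPart _) x)
  by_cases hb : BddBelow (range fun t : Icc (0 : ℝ) T => lambdaMin (symPart (c.BB t)))
  · exact ciInf_le hb ⟨t, ht⟩
  · exact absurd (Real.iInf_of_not_bddBelow hb) h.ne'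

/-- An unbounded real supremum would be 0 by default; this is what makes `K3` and `K4` genuine upper
bounds. -/
lemma bddAbove_sigmaMax_sq {F : ℝ → Matrix (Fin n) (Fin n) ℝ} (hF : IsBoundedMeasurable T F) :
    BddAbove (range fun t : Icc (0 : ℝ) T => sigmaMax (F t) ^ 2) := by
  obtain ⟨C, -, hC⟩ := hF.exists_norm_le
  refine ⟨C ^ 2 * ‖(1 : Matrix (Fin n) (Fin n) ℝ)‖, ?_⟩
  rintro _ ⟨t, rfl⟩
  exact (sigmaMax_sq_le _).trans (mul_le_mul_of_nonneg_right
    (pow_le_pow_left₀ (norm_nonneg _) (hC t t.2) 2) (norm_nonneg _))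

lemma le_K5_mul (hc : c.Admissible T) {t : ℝ} (ht : t ∈ Icc 0 T) (x : Fin n → ℝ) :
    x ⬝ᵥ c.RS t *ᵥ x ≤ c.K5 T * l2norm x ^ 2 := by
  rw [← dotProduct_symPart_mulVec]
  refine (le_lambdaMax_mul (isHermitian_symPart _) x).trans
    (mul_le_mul_of_nonneg_right ?_ (sq_nonneg _))
  refine le_ciSup (f := fun t : Icc (0 : ℝ) T => lambdaMax (symPart (c.RS t))) ?_ ⟨t, ht⟩
  obtain ⟨C, -, hC⟩ := hc.RS_bdd.exists_norm_le
  refine ⟨C * ‖(1 : Matrix (Fin n) (Fin n) ℝ)‖, ?_⟩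
  rintro _ ⟨t, rfl⟩
  exact (lambdaMax_le_norm _).trans (mul_le_mul_of_nonneg_right
    ((norm_symPart_le _).trans (hC t t.2)) (norm_nonneg _))

lemma Condition3.energyRate_neg (hc : c.Admissible T) (h : c.Condition3 T) {t : ℝ}
    (ht : t ∈ Icc 0 T) (x y : Fin n → ℝ) :
    c.energyRate t x y ≤ 0 ∧ (c.energyRate t x y = 0 → y = 0) := by
  obtain ⟨h1, h2, h3⟩ := h
  have e1 := K1_mul_le h1 ht x
  have e2 := K2_mul_le h2 ht y
  have e3 : sigmaMax (c.driftPert t) ^ 2 ≤ c.K3 T :=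
    le_ciSup (f := fun t : Icc (0 : ℝ) T => sigmaMax (c.driftPert t) ^ 2)
      (bddAbove_sigmaMax_sq hc.driftPert_bdd) ⟨t, ht⟩
  have e4 : sigmaMax (c.RB t) ^ 2 ≤ c.K4 T :=
    le_ciSup (f := fun t : Icc (0 : ℝ) T => sigmaMax (c.RB t) ^ 2)
      (bddAbove_sigmaMax_sq hc.RB_bdd) ⟨t, ht⟩
  have e5 := le_K5_mul hc ht x
  have e6 : y ⬝ᵥ c.driftPert t *ᵥ x ≤ l2norm y * (sigmaMax (c.driftPert t) * l2norm x) :=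
    ((le_abs_self _).trans (abs_dotProduct_le _ _)).trans
      (mul_le_mul_of_nonneg_left (l2norm_mulVec_le_sigmaMax _ _) (l2norm_nonneg _))
  have e7 : x ⬝ᵥ c.RB t *ᵥ y ≤ l2norm x * (sigmaMax (c.RB t) * l2norm y) :=
    ((le_abs_self _).trans (abs_dotProduct_le _ _)).trans
      (mul_le_mul_of_nonneg_left (l2norm_mulVec_le_sigmaMax _ _) (l2norm_nonneg _))
  rw [Matrix.add_mulVec, dotProduct_add] at e1
  set X := l2norm x
  set Y := l2norm y
  set p := sigmaMax (c.driftPert t)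
  set q := sigmaMax (c.RB t)
  set d := 2 * c.K1 T * c.K2 T - 2 * c.K2 T * c.K5 T - c.K3 T - c.K4 T with hd
  have hd0 : 0 < d := by rw [hd]; linarith
  -- In Euclidean norms the rate is at most -(K₁-K₅)X² + (p+q)XY - K₂Y². Multiplying by 2K₂ and
  -- completing the square in Y leaves (p+q)²/2 ≤ p²+q² ≤ K₃+K₄ in front of X², which produces the
  -- gap `d`.
  have key : 2 * c.K2 T * c.energyRate t x y ≤
      -(d * X ^ 2) - 1 / 2 * ((p + q) * X - 2 * c.K2 T * Y) ^ 2 := by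
    have h8 : c.energyRate t x y ≤ -(c.K1 T * X ^ 2) + c.K5 T * X ^ 2 + (p + q) * X * Y
        - c.K2 T * Y ^ 2 := by
      rw [energyRate]; linarith
    have h9 : (p + q) ^ 2 ≤ 2 * (c.K3 T + c.K4 T) := by nlinarith [sq_nonneg (p - q)]
    have h10 := mul_le_mul_of_nonneg_left h8 (by linarith : 0 ≤ 2 * c.K2 T)
    have h11 := mul_le_mul_of_nonneg_right h9 (sq_nonneg X)
    rw [hd]
    nlinarith
  have hdX : 0 ≤ d * X ^ 2 := mul_nonneg hd0.le (sq_nonneg X)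
  have hsq := sq_nonneg ((p + q) * X - 2 * c.K2 T * Y)
  refine ⟨?_, fun h0 => ?_⟩
  · by_contra! hlt
    have := mul_pos (mul_pos two_pos h2) hlt
    linarith
  · rw [h0, mul_zero] at key
    have hX : X = 0 := by
      have : d * X ^ 2 = 0 := by linarith
      simpa [hd0.ne'] using this
    have hY : Y = 0 := by
      have : ((p + q) * X - 2 * c.K2 T * Y) ^ 2 = 0 := by linarith
      simpa [hX, h2.ne'] using this
    exact l2norm_eq_zero.1 hY

lemma Condition3.terminal_nonneg (hT : 0 ≤ T) (h : c.Condition3 T) (x : Fin n → ℝ) :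
    0 ≤ x ⬝ᵥ c.terminal T *ᵥ x :=
  (mul_nonneg h.1.le (sq_nonneg _)).trans (K1_mul_le h.1 ⟨hT, le_rfl⟩ x)

end Monotone

end LQCoeff

/-! ### Weighted norms and the case of small coefficients -/

namespace LQCoeff

variable {n m : ℕ} {c : LQCoeff n m} {T : ℝ}

/-- `|Qₜ^{1/2} x|`. -/
noncomputable def normQ (c : LQCoeff n m) (t : ℝ) (x : Fin n → ℝ) : ℝ :=
  l2norm (CFC.sqrt (c.Q t) *ᵥ x)

/-- `|(B P⁻¹ Bᵀ)ₜ^{1/2} y|`. -/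
noncomputable def normM (c : LQCoeff n m) (t : ℝ) (y : Fin n → ℝ) : ℝ :=
  l2norm (CFC.sqrt (c.BPB t) *ᵥ y)

lemma normQ_nonneg (t : ℝ) (x : Fin n → ℝ) : 0 ≤ c.normQ t x := l2norm_nonneg _

lemma normM_nonneg (t : ℝ) (x : Fin n → ℝ) : 0 ≤ c.normM t x := l2norm_nonneg _

lemma Admissible.BPB_posSemidef (hc : c.Admissible T) {t : ℝ} (ht : t ∈ Icc 0 T) :
    (c.BPB t).PosSemidef := by
  have := (hc.P_nonneg t ht).inv.mul_mul_conjTranspose_same (c.B t)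
  rwa [Matrix.conjTranspose_eq_transpose_of_trivial] at this

lemma Admissible.normQ_sq (hc : c.Admissible T) {t : ℝ} (ht : t ∈ Icc 0 T) (x : Fin n → ℝ) :
    x ⬝ᵥ c.Q t *ᵥ x = c.normQ t x ^ 2 := (hc.Q_nonneg t ht).dotProduct_mulVec_eq_sqrt x

lemma Admissible.normM_sq (hc : c.Admissible T) {t : ℝ} (ht : t ∈ Icc 0 T) (x : Fin n → ℝ) :
    x ⬝ᵥ c.BPB t *ᵥ x = c.normM t x ^ 2 := (hc.BPB_posSemidef ht).dotProduct_mulVec_eq_sqrt x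

lemma Admissible.isUnit_sqrt_Q (hc : c.Admissible T) (hw : c.WeightsInvertible T) {t : ℝ}
    (ht : t ∈ Icc 0 T) : IsUnit (CFC.sqrt (c.Q t)) :=
  (hc.Q_nonneg t ht).isUnit_sqrt (hw t ht).1

lemma Admissible.isUnit_sqrt_BPB (hc : c.Admissible T) (hw : c.WeightsInvertible T) {t : ℝ}
    (ht : t ∈ Icc 0 T) : IsUnit (CFC.sqrt (c.BPB t)) :=
  (hc.BPB_posSemidef ht).isUnit_sqrt (hw t ht).2.2

lemma Admissible.eq_zero_of_normM (hc : c.Admissible T) (hw : c.WeightsInvertible T) {t : ℝ}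
    (ht : t ∈ Icc 0 T) {y : Fin n → ℝ} (h : c.normM t y = 0) : y = 0 :=
  Matrix.mulVec_injective_iff_isUnit.2 (hc.isUnit_sqrt_BPB hw ht)
    ((l2norm_eq_zero.1 h).trans (Matrix.mulVec_zero _).symm)

/-- `B P⁻¹ Bᵀ - (B + B̄)(P + 𝒫)⁻¹ Bᵀ = (B P⁻¹ 𝒫 - B̄)(P + 𝒫)⁻¹ Bᵀ`. -/
lemma BB_eq_sub {t : ℝ} (hP : IsUnit (c.P t)) (hP' : IsUnit (c.P t + c.calP t)) :
    c.BB t = c.BPB t - c.controlPert t := by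
  have h1 := (Matrix.isUnit_iff_isUnit_det _).1 hP
  have h2 := (Matrix.isUnit_iff_isUnit_det _).1 hP'
  have h : c.B t * (c.P t)⁻¹ * c.calP t - c.Bbar t =
      c.B t * (c.P t)⁻¹ * (c.P t + c.calP t) - (c.B t + c.Bbar t) := by
    rw [Matrix.mul_add, Matrix.nonsing_inv_mul_cancel_right _ _ h1]
    abel
  rw [controlPert, h, Matrix.sub_mul, Matrix.sub_mul, invP,
    Matrix.mul_nonsing_inv_cancel_right _ _ h2, BPB, BB, invP]
  abel

/-- Pointwise bounds on the perturbations as bilinear forms in the weighted norms. -/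
structure PerturbationBound (c : LQCoeff n m) (T a₁ a₂ q r b : ℝ) : Prop where
  a₁_nonneg : 0 ≤ a₁
  a₂_nonneg : 0 ≤ a₂
  q_nonneg : 0 ≤ q
  r_nonneg : 0 ≤ r
  b_nonneg : 0 ≤ b
  drift : ∀ t ∈ Icc 0 T, ∀ x y, |y ⬝ᵥ c.driftPert t *ᵥ x| ≤ a₁ * (c.normQ t x * c.normM t y)
  control : ∀ t ∈ Icc 0 T, ∀ x y,
    |x ⬝ᵥ c.controlPert t *ᵥ y| ≤ a₂ * (c.normM t x * c.normM t y)
  calQ : ∀ t ∈ Icc 0 T, ∀ x y, |x ⬝ᵥ c.calQ t *ᵥ y| ≤ q * (c.normQ t x * c.normQ t y)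
  RS : ∀ t ∈ Icc 0 T, ∀ x y, |x ⬝ᵥ c.RS t *ᵥ y| ≤ r * (c.normQ t x * c.normQ t y)
  RB : ∀ t ∈ Icc 0 T, ∀ x y, |x ⬝ᵥ c.RB t *ᵥ y| ≤ b * (c.normQ t x * c.normM t y)

lemma PerturbationBound.mono {T' a₁ a₂ q r b : ℝ} (h : c.PerturbationBound T a₁ a₂ q r b)
    (hT : T' ≤ T) : c.PerturbationBound T' a₁ a₂ q r b where
  a₁_nonneg := h.a₁_nonneg
  a₂_nonneg := h.a₂_nonneg
  q_nonneg := h.q_nonneg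
  r_nonneg := h.r_nonneg
  b_nonneg := h.b_nonneg
  drift t ht := h.drift t ⟨ht.1, ht.2.trans hT⟩
  control t ht := h.control t ⟨ht.1, ht.2.trans hT⟩
  calQ t ht := h.calQ t ⟨ht.1, ht.2.trans hT⟩
  RS t ht := h.RS t ⟨ht.1, ht.2.trans hT⟩
  RB t ht := h.RB t ⟨ht.1, ht.2.trans hT⟩

lemma norm_le_toReal_iSup {E : Type*} [SeminormedAddGroup E] {s : Set ℝ} {F : ℝ → E}
    (h : (⨆ t ∈ s, ‖F t‖ₑ) ≠ ⊤) {t : ℝ} (ht : t ∈ s) : ‖F t‖ ≤ (⨆ t ∈ s, ‖F t‖ₑ).toReal := by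
  rw [← toReal_enorm]
  exact ENNReal.toReal_mono h (le_iSup₂ (f := fun t (_ : t ∈ s) => ‖F t‖ₑ) t ht)

/-- Finite sizes allow the passage from suprema in [0,∞] to real constants, namely the weighted
norms themselves. The drift is measured through its transpose because y·Dx = x·Dᵀy pairs the
Q-weight of x with the M-weight of y. -/
lemma exists_perturbationBound (hc : c.Admissible T) (hw : c.WeightsInvertible T)
    (hf : c.fwdSize T ≠ ⊤) (hb : c.bwdSize T ≠ ⊤) :
    ∃ a₁ a₂ q r b, c.PerturbationBound T a₁ a₂ q r b ∧
      c.fwdSize T = ENNReal.ofReal (a₁ ^ 2 + a₂ ^ 2) ∧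
      c.bwdSize T = ENNReal.ofReal ((q + r) ^ 2 + b ^ 2) := by
  simp only [fwdSize, bwdSize, ne_eq, ENNReal.add_eq_top, ENNReal.pow_eq_top_iff, not_or,
    OfNat.ofNat_ne_zero, not_false_eq_true, and_true] at hf hb
  obtain ⟨h1, h2⟩ := hf
  obtain ⟨⟨h3, h4⟩, h5⟩ := hb
  refine ⟨_, _, _, _, _, ⟨ENNReal.toReal_nonneg (a := c.norm2 T fun t => (c.driftPert t)ᵀ),
    ENNReal.toReal_nonneg (a := c.norm3 T c.controlPert),
    ENNReal.toReal_nonneg (a := c.norm1 T c.calQ), ENNReal.toReal_nonneg (a := c.norm1 T c.RS),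
    ENNReal.toReal_nonneg (a := c.norm2 T c.RB), fun t ht x y => ?_, fun t ht x y => ?_,
    fun t ht x y => ?_, fun t ht x y => ?_, fun t ht x y => ?_⟩, ?_, ?_⟩
  · rw [dotProduct_mulVec_comm, dotProduct_comm]
    exact (abs_dotProduct_mulVec_le_weighted (hc.isUnit_sqrt_Q hw ht) (hc.isUnit_sqrt_BPB hw ht)
      (Matrix.transpose_cfcSqrt _) _ _).trans
      (mul_le_mul_of_nonneg_right (norm_le_toReal_iSup h1 ht)
        (mul_nonneg (l2norm_nonneg _) (l2norm_nonneg _)))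
  · exact (abs_dotProduct_mulVec_le_weighted (hc.isUnit_sqrt_BPB hw ht)
      (hc.isUnit_sqrt_BPB hw ht) (Matrix.transpose_cfcSqrt _) _ _).trans
      (mul_le_mul_of_nonneg_right (norm_le_toReal_iSup h2 ht)
        (mul_nonneg (l2norm_nonneg _) (l2norm_nonneg _)))
  · exact (abs_dotProduct_mulVec_le_weighted (hc.isUnit_sqrt_Q hw ht)
      (hc.isUnit_sqrt_Q hw ht) (Matrix.transpose_cfcSqrt _) _ _).trans
      (mul_le_mul_of_nonneg_right (norm_le_toReal_iSup h3 ht)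
        (mul_nonneg (l2norm_nonneg _) (l2norm_nonneg _)))
  · exact (abs_dotProduct_mulVec_le_weighted (hc.isUnit_sqrt_Q hw ht)
      (hc.isUnit_sqrt_Q hw ht) (Matrix.transpose_cfcSqrt _) _ _).trans
      (mul_le_mul_of_nonneg_right (norm_le_toReal_iSup h4 ht)
        (mul_nonneg (l2norm_nonneg _) (l2norm_nonneg _)))
  · exact (abs_dotProduct_mulVec_le_weighted (hc.isUnit_sqrt_Q hw ht)
      (hc.isUnit_sqrt_BPB hw ht) (Matrix.transpose_cfcSqrt _) _ _).trans
      (mul_le_mul_of_nonneg_right (norm_le_toReal_iSup h5 ht)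
        (mul_nonneg (l2norm_nonneg _) (l2norm_nonneg _)))
  · rw [fwdSize, ENNReal.ofReal_add (by positivity) (by positivity),
      ENNReal.ofReal_pow ENNReal.toReal_nonneg, ENNReal.ofReal_pow ENNReal.toReal_nonneg,
      ENNReal.ofReal_toReal h1, ENNReal.ofReal_toReal h2]
  · rw [bwdSize, ENNReal.ofReal_add (by positivity) (by positivity),
      ENNReal.ofReal_pow (by positivity), ENNReal.ofReal_pow ENNReal.toReal_nonneg,
      ENNReal.ofReal_add ENNReal.toReal_nonneg ENNReal.toReal_nonneg,
      ENNReal.ofReal_toReal h3, ENNReal.ofReal_toReal h4, ENNReal.ofReal_toReal h5]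

namespace PerturbationBound

variable {a₁ a₂ q r b : ℝ}

/-- Writing `BB` as M minus `controlPert` isolates the exact weight -(|Q^{1/2}x|² + |M^{1/2}y|²);
all other terms are perturbations. -/
lemma energyRate_le (h : c.PerturbationBound T a₁ a₂ q r b) (hc : c.Admissible T)
    (hw : c.WeightsInvertible T) {t : ℝ} (ht : t ∈ Icc 0 T) (x y : Fin n → ℝ) :
    c.energyRate t x y ≤ -(c.normQ t x ^ 2 + c.normM t y ^ 2) +
      ((q + r) * c.normQ t x + b * c.normM t y) * c.normQ t x +
      (a₁ * c.normQ t x + a₂ * c.normM t y) * c.normM t y := by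
  have h1 := (le_abs_self _).trans (h.drift t ht x y)
  have h2 := (le_abs_self _).trans (h.control t ht y y)
  have h3 := (neg_le_abs _).trans (h.calQ t ht x x)
  have h4 := (le_abs_self _).trans (h.RS t ht x x)
  have h5 := (le_abs_self _).trans (h.RB t ht x y)
  rw [energyRate, BB_eq_sub (hw t ht).2.1 (hc.isUnit_P_add t ht), Matrix.sub_mulVec,
    dotProduct_sub, hc.normQ_sq ht, hc.normM_sq ht]
  linarith

lemma terminal_ge (h : c.PerturbationBound T a₁ a₂ q r b) (hc : c.Admissible T)
    (hT : 0 ≤ T) (x : Fin n → ℝ) :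
    (1 - q) * c.normQ T x ^ 2 ≤ x ⬝ᵥ c.terminal T *ᵥ x := by
  have hTm : T ∈ Icc 0 T := ⟨hT, le_rfl⟩
  have h3 := (neg_le_abs _).trans (h.calQ T hTm x x)
  rw [terminal, Matrix.add_mulVec, dotProduct_add, hc.normQ_sq hTm]
  linarith

lemma energyRate_neg (h : c.PerturbationBound T a₁ a₂ q r b) (hc : c.Admissible T)
    (hw : c.WeightsInvertible T) (hlt : a₁ ^ 2 + a₂ ^ 2 + ((q + r) ^ 2 + b ^ 2) < 1)
    {t : ℝ} (ht : t ∈ Icc 0 T) (x y : Fin n → ℝ) :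
    c.energyRate t x y ≤ 0 ∧ (c.energyRate t x y = 0 → y = 0) := by
  have h1 := h.energyRate_le hc hw ht x y
  set u := c.normQ t x
  set v := c.normM t y with hv
  set θ := a₁ ^ 2 + a₂ ^ 2 + ((q + r) ^ 2 + b ^ 2)
  -- The left side is the product of (u, v) with its image under the matrix with rows (q+r, b) and
  -- (a₁, a₂), whose squared Frobenius norm is θ. Using 2xy ≤ x² + y² gives (1+θ)/2, which is below
  -- 1 and avoids √θ.
  have h2 : ((q + r) * u + b * v) * u + (a₁ * u + a₂ * v) * v ≤ (1 + θ) / 2 * (u ^ 2 + v ^ 2) := by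
    nlinarith [sq_nonneg ((q + r) * u + b * v - u), sq_nonneg (a₁ * u + a₂ * v - v),
      sq_nonneg ((q + r) * v - b * u), sq_nonneg (a₁ * v - a₂ * u)]
  have h3 : c.energyRate t x y ≤ -((1 - θ) / 2 * (u ^ 2 + v ^ 2)) := by linarith
  have h4 : 0 < (1 - θ) / 2 := by linarith
  refine ⟨h3.trans (neg_nonpos.2 (by positivity)), fun h0 => ?_⟩
  have h5 : u ^ 2 + v ^ 2 ≤ 0 := by
    by_contra! hpos
    have := mul_pos h4 hpos
    linarith
  exact hc.eq_zero_of_normM hw ht (by nlinarith : v = 0)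

end PerturbationBound

/-- Uniqueness for the forward-backward system when the perturbations are small. -/
lemma Condition1.unique (hT : 0 ≤ T) (hc : c.Admissible T) (h : c.Condition1 T)
    (ξ η : ℝ → Fin n → ℝ) (t₀ : ℝ) (ht₀ : t₀ ∈ Icc 0 T) (hflow : c.IsHamiltonianFlow T ξ η)
    (h0 : ξ t₀ = 0) (hend : η T = c.terminal T *ᵥ ξ T) : η t₀ = 0 := by
  obtain ⟨hw, hlt⟩ := h
  have hsum : c.fwdSize T + c.bwdSize T < 1 := by
    rw [fwdSize, bwdSize, add_comm (_ ^ 2) (c.norm2 T c.RB ^ 2), ← add_assoc]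
    exact hlt
  obtain ⟨a₁, a₂, q, r, b, hB, h1, h2⟩ := exists_perturbationBound hc hw
    (ne_top_of_lt (lt_of_le_of_lt le_self_add hsum))
    (ne_top_of_lt (lt_of_le_of_lt le_add_self hsum))
  rw [h1, h2, ← ENNReal.ofReal_add (by positivity) (by positivity), ENNReal.ofReal_lt_one] at hsum
  refine hflow.eq_zero_of_energyRate ht₀ h0 hend (fun x => le_trans ?_ (hB.terminal_ge hc hT x))
    fun t ht x y => hB.energyRate_neg hc hw hsum ht x y
  have := hB.r_nonneg
  have := hB.q_nonneg
  have hq : q < 1 := by nlinarith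
  exact mul_nonneg (by linarith) (sq_nonneg _)

/-- Uniqueness for the forward-backward system in the monotone case. -/
lemma Condition3.unique (hT : 0 ≤ T) (hc : c.Admissible T) (h : c.Condition3 T)
    (ξ η : ℝ → Fin n → ℝ) (t₀ : ℝ) (ht₀ : t₀ ∈ Icc 0 T) (hflow : c.IsHamiltonianFlow T ξ η)
    (h0 : ξ t₀ = 0) (hend : η T = c.terminal T *ᵥ ξ T) : η t₀ = 0 :=
  hflow.eq_zero_of_energyRate ht₀ h0 hend (h.terminal_nonneg hT)
    fun _ ht x y => h.energyRate_neg hc ht x y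

end LQCoeff

/-! ### The case of a short horizon -/

lemma mul_add_mul_le_of_sq_eq {p q u v s w : ℝ} (hs : 0 ≤ s) (hw : 0 ≤ w)
    (hs2 : s ^ 2 = p ^ 2 + q ^ 2) (hw2 : w ^ 2 = u ^ 2 + v ^ 2) : p * u + q * v ≤ s * w := by
  refine (le_abs_self _).trans (abs_le_of_sq_le_sq ?_ (mul_nonneg hs hw))
  rw [mul_pow, hs2, hw2]
  nlinarith [sq_nonneg (p * v - q * u)]

/-- The Cauchy–Schwarz inequality recovered from Young's inequality with a free parameter. Estimates
can thus be integrated termwise for fixed `l`, and `l` is chosen only at the end. -/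
lemma sq_le_mul_of_forall_two_mul_le {v a b : ℝ} (hv : 0 ≤ v) (ha : 0 ≤ a) (hb : 0 ≤ b)
    (h : ∀ l : ℝ, 0 < l → 2 * v ≤ l * a + b / l) : v ^ 2 ≤ a * b := by
  rcases hv.eq_or_lt with rfl | hv
  · simpa using mul_nonneg ha hb
  rcases ha.eq_or_lt with rfl | ha
  · have h1 := h ((b + 1) / v) (by positivity)
    have h2 : b / ((b + 1) / v) ≤ v := by
      rw [div_div_eq_mul_div, div_le_iff₀ (by positivity)]
      nlinarith
    linarith
  · have h1 := h (v / a) (by positivity)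
    rw [div_mul_cancel₀ _ ha.ne', div_div_eq_mul_div] at h1
    have h2 : v ≤ b * a / v := by linarith
    rw [le_div_iff₀ hv] at h2
    linarith

lemma mul_le_half_young (x y : ℝ) {l : ℝ} (hl : 0 < l) :
    x * y ≤ 1 / 2 * (l * x ^ 2 + y ^ 2 / l) := by
  have h : 0 ≤ (l * x - y) ^ 2 / l := by positivity
  have h2 : (l * x - y) ^ 2 / l = l * x ^ 2 - 2 * (x * y) + y ^ 2 / l := by
    field_simp
    ring
  linarith

namespace LQCoeff

variable {n m : ℕ} {c : LQCoeff n m} {T : ℝ}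

/-- `ξ · Q ξ + η · B P⁻¹ Bᵀ η`. -/
noncomputable def weight (c : LQCoeff n m) (t : ℝ) (x y : Fin n → ℝ) : ℝ :=
  x ⬝ᵥ c.Q t *ᵥ x + y ⬝ᵥ c.BPB t *ᵥ y

lemma Admissible.weight_eq (hc : c.Admissible T) {t : ℝ} (ht : t ∈ Icc 0 T) (x y : Fin n → ℝ) :
    c.weight t x y = c.normQ t x ^ 2 + c.normM t y ^ 2 := by
  rw [weight, hc.normQ_sq ht, hc.normM_sq ht]

lemma Admissible.weight_nonneg (hc : c.Admissible T) {t : ℝ} (ht : t ∈ Icc 0 T)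
    (x y : Fin n → ℝ) : 0 ≤ c.weight t x y := by
  rw [hc.weight_eq ht]; positivity

/-- The kernel `(B P⁻¹ Bᵀ)ₜ^{1/2} Ψ(s,t)ᵀ Qₛ^{1/2}`. -/
noncomputable def kernel (c : LQCoeff n m) (Ψ : ℝ → ℝ → Matrix (Fin n) (Fin n) ℝ) (s t : ℝ) :
    Matrix (Fin n) (Fin n) ℝ :=
  CFC.sqrt (c.BPB t) * (Ψ s t)ᵀ * CFC.sqrt (c.Q s)

variable {Ψ : ℝ → ℝ → Matrix (Fin n) (Fin n) ℝ}

lemma kernel_le_norm0 {t : ℝ} (ht : t ∈ Icc 0 T) :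
    ‖c.kernel Ψ T t‖ₑ ^ 2 + ∫⁻ s in Icc t T, ‖c.kernel Ψ s t‖ₑ ^ 2 ≤
      c.norm0 T (fun s t => (Ψ s t)ᵀ) ^ 2 := by
  have h : (‖c.kernel Ψ T t‖ₑ ^ 2 + ∫⁻ s in Icc t T, ‖c.kernel Ψ s t‖ₑ ^ 2) ^ (1 / 2 : ℝ) ≤
      c.norm0 T (fun s t => (Ψ s t)ᵀ) :=
    le_iSup₂ (f := fun t (_ : t ∈ Icc 0 T) =>
      (‖c.kernel Ψ T t‖ₑ ^ 2 + ∫⁻ s in Icc t T, ‖c.kernel Ψ s t‖ₑ ^ 2) ^ (1 / 2 : ℝ)) t ht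
  have h2 := pow_le_pow_left' h 2
  rwa [← ENNReal.rpow_natCast, ← ENNReal.rpow_mul, show (1 / 2 : ℝ) * (2 : ℕ) = 1 by norm_num,
    ENNReal.rpow_one] at h2

lemma norm_kernel_terminal_le (hN : c.norm0 T (fun s t => (Ψ s t)ᵀ) ≠ ⊤) {t : ℝ}
    (ht : t ∈ Icc 0 T) :
    ‖c.kernel Ψ T t‖ ≤ (c.norm0 T (fun s t => (Ψ s t)ᵀ)).toReal := by
  rw [← toReal_enorm]
  refine ENNReal.toReal_mono hN ?_
  exact (ENNReal.pow_right_strictMono two_ne_zero).le_iff_le.1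
    (le_self_add.trans (kernel_le_norm0 ht))

/-- By the C*-identity ‖K‖² = ‖KKᵀ‖, and KKᵀ contains Q_s rather than its square root, so
measurability of s ↦ Q_s^{1/2} is never needed. -/
lemma Admissible.norm_kernel_sq_measurable (hc : c.Admissible T)
    (hΨ : IsFundamentalSolution T c.A Ψ) {t : ℝ} (ht : t ∈ Icc 0 T) :
    AEStronglyMeasurable (fun s => ‖c.kernel Ψ s t‖ ^ 2) (volume.restrict (Icc 0 T)) := by
  have hΨm := (hΨ.isMatrixACDeriv hc.A_bdd ht).isBoundedMeasurable.entrywiseMeasurable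
  have hm := (((EntrywiseMeasurable.const (T := T) (CFC.sqrt (c.BPB t))).mul hΨm.transpose).mul
    hc.Q_bdd.1).mul (hΨm.mul (EntrywiseMeasurable.const (CFC.sqrt (c.BPB t))))
  refine hm.aestronglyMeasurable.norm.congr ((ae_restrict_iff' measurableSet_Icc).2
    (.of_forall fun s hs => ?_))
  have h1 : ‖c.kernel Ψ s t‖ ^ 2 = ‖c.kernel Ψ s t * (c.kernel Ψ s t)ᵀ‖ := by
    have := Matrix.l2_opNorm_conjTranspose_mul_self (c.kernel Ψ s t)ᵀ
    rw [Matrix.conjTranspose_eq_transpose_of_trivial, Matrix.transpose_transpose,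
      l2_opNorm_transpose] at this
    rw [this, sq]
  simp only
  rw [h1]
  congr 1
  conv_lhs => rw [← CFC.sqrt_mul_sqrt_self (c.Q s) (hc.Q_nonneg s hs).nonneg]
  simp only [kernel, Matrix.transpose_mul, Matrix.transpose_transpose, Matrix.transpose_cfcSqrt,
    Matrix.mul_assoc]

lemma Admissible.norm_kernel_sq_integral_le (hc : c.Admissible T)
    (hΨ : IsFundamentalSolution T c.A Ψ) (hN : c.norm0 T (fun s t => (Ψ s t)ᵀ) ≠ ⊤) {t : ℝ}
    (ht : t ∈ Icc 0 T) :
    IntervalIntegrable (fun s => ‖c.kernel Ψ s t‖ ^ 2) volume t T ∧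
      ‖c.kernel Ψ T t‖ ^ 2 + ∫ s in t..T, ‖c.kernel Ψ s t‖ ^ 2 ≤
        (c.norm0 T (fun s t => (Ψ s t)ᵀ)).toReal ^ 2 := by
  have h := kernel_le_norm0 (c := c) (Ψ := Ψ) ht
  have htop : c.norm0 T (fun s t => (Ψ s t)ᵀ) ^ 2 ≠ ⊤ := ENNReal.pow_ne_top hN
  have hm := (hc.norm_kernel_sq_measurable hΨ ht).mono_set (Icc_subset_Icc_left ht.1 :
    Icc t T ⊆ Icc 0 T)
  have he : ∀ s, ENNReal.ofReal (‖c.kernel Ψ s t‖ ^ 2) = ‖c.kernel Ψ s t‖ₑ ^ 2 := fun s => by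
    rw [ENNReal.ofReal_pow (norm_nonneg _), ofReal_norm]
  have hfin : ∫⁻ s in Icc t T, ‖c.kernel Ψ s t‖ₑ ^ 2 ≠ ⊤ :=
    ne_top_of_le_ne_top htop (le_add_self.trans h)
  have hint : IntegrableOn (fun s => ‖c.kernel Ψ s t‖ ^ 2) (Icc t T) := by
    refine ⟨hm, ?_⟩
    rw [hasFiniteIntegral_iff_ofReal (.of_forall fun s => by positivity)]
    simp only [he]
    exact hfin.lt_top
  refine ⟨(intervalIntegrable_iff_integrableOn_Icc_of_le ht.2).2 hint, ?_⟩
  rw [intervalIntegral.integral_of_le ht.2, ← integral_Icc_eq_integral_Ioc,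
    integral_eq_lintegral_of_nonneg_ae (.of_forall fun s => by positivity) hm,
    ← ENNReal.toReal_pow]
  simp only [he]
  rw [← toReal_enorm, ← ENNReal.toReal_pow, ← ENNReal.toReal_add (by simp) hfin]
  exact ENNReal.toReal_mono htop h

/-- Finiteness of the propagator norm bounds `B P⁻¹ Bᵀ` along continuous functions. -/
lemma Admissible.exists_normM_le (hc : c.Admissible T) (hw : c.WeightsInvertible T) (hT : 0 ≤ T)
    (hΨ : IsFundamentalSolution T c.A Ψ) (hN : c.norm0 T (fun s t => (Ψ s t)ᵀ) ≠ ⊤)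
    {η η' : ℝ → Fin n → ℝ} (hη : IsVectorACDeriv T η η') :
    ∃ C, ∀ t ∈ Icc 0 T, c.normM t (η t) ≤ C := by
  have hTm : T ∈ Icc 0 T := ⟨hT, le_rfl⟩
  obtain ⟨X, Y, hX, hY, hXY⟩ := hc.A_bdd.exists_isMatrixACDeriv_inverse hT
  -- M may be unbounded, since P⁻¹ is not assumed bounded. The vector `z` undoes the factors Ψ(T,t)ᵀ
  -- and Q_T^{1/2}, so that M^{1/2}η is the kernel at (T,t) applied to a continuous function.
  set z : ℝ → Fin n → ℝ := fun t => ((CFC.sqrt (c.Q T))⁻¹ * (X t * Y T)ᵀ) *ᵥ η t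
  have hz : ContinuousOn z (Icc 0 T) :=
    (IsVectorACDeriv.mulVec ((hX.mul_const (Y T)).transpose.const_mul _) hη).continuousOn
  obtain ⟨C, hC⟩ := isCompact_Icc.exists_bound_of_continuousOn
    (continuous_l2norm.comp_continuousOn hz)
  refine ⟨(c.norm0 T (fun s t => (Ψ s t)ᵀ)).toReal * C, fun t ht => ?_⟩
  have h1 : CFC.sqrt (c.BPB t) *ᵥ η t = c.kernel Ψ T t *ᵥ z t := by
    have hdet := (Matrix.isUnit_iff_isUnit_det _).1 (hc.isUnit_sqrt_Q hw hTm)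
    have h2 : (Ψ T t)ᵀ * (X t * Y T)ᵀ = 1 := by
      rw [hΨ.eq_mul hc.A_bdd hY (fun t ht => (hXY t ht).1) ht hTm, ← Matrix.transpose_mul,
        Matrix.mul_assoc, ← Matrix.mul_assoc (Y T), (hXY T hTm).2, Matrix.one_mul,
        (hXY t ht).1, Matrix.transpose_one]
    simp only [z, kernel, Matrix.mulVec_mulVec]
    rw [← Matrix.mul_assoc, Matrix.mul_nonsing_inv_cancel_right _ _ hdet, Matrix.mul_assoc, h2,
      Matrix.mul_one]
  rw [normM, h1]
  refine (l2norm_mulVec_le _ _).trans (mul_le_mul (norm_kernel_terminal_le hN ht)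
    ((le_abs_self _).trans (hC t ht)) (l2norm_nonneg _) ENNReal.toReal_nonneg)

lemma Admissible.integrableOn_weight (hc : c.Admissible T) {ξ η : ℝ → Fin n → ℝ}
    (hξ : ContinuousOn ξ (Icc 0 T)) (hη : ContinuousOn η (Icc 0 T)) {C : ℝ}
    (hC : ∀ t ∈ Icc 0 T, c.normM t (η t) ≤ C) :
    IntegrableOn (fun t => c.weight t (ξ t) (η t)) (Icc 0 T) := by
  have hm : ∀ {F : ℝ → Matrix (Fin n) (Fin n) ℝ} {x : ℝ → Fin n → ℝ}, EntrywiseMeasurable T F →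
      ContinuousOn x (Icc 0 T) →
      AEStronglyMeasurable (fun t => x t ⬝ᵥ F t *ᵥ x t) (volume.restrict (Icc 0 T)) := by
    intro F x hF hx
    have hx' : ∀ i, AEMeasurable (fun t => x t i) (volume.restrict (Icc 0 T)) := fun i =>
      (continuousOn_pi.1 hx i).aemeasurable measurableSet_Icc
    simp only [Matrix.mulVec, dotProduct]
    exact (Finset.aemeasurable_fun_sum _ fun i _ => (hx' i).mul
      (Finset.aemeasurable_fun_sum _ fun j _ => (hF i j).mul (hx' j))).aestronglyMeasurable
  have hQ : IntegrableOn (fun t => ξ t ⬝ᵥ c.Q t *ᵥ ξ t) (Icc 0 T) := by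
    simp only [dotProduct]
    exact integrable_finsetSum _ fun i _ => (hc.Q_bdd.integrableOn_mulVec hξ i).continuousOn_mul
      (continuousOn_pi.1 hξ i) isCompact_Icc
  refine hQ.add (IntegrableOn.of_bound measure_Icc_lt_top (hm hc.BPB_measurable hη) (C ^ 2)
    ((ae_restrict_iff' measurableSet_Icc).2 (.of_forall fun t ht => ?_)))
  rw [hc.normM_sq ht, Real.norm_eq_abs, abs_of_nonneg (sq_nonneg _)]
  exact pow_le_pow_left₀ (normM_nonneg _ _) (hC t ht) 2

/-- Q_s^{1/2} Ψ(s,t) M_t^{1/2} is the transpose of the kernel, and transposition preserves the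
operator norm. -/
lemma normQ_mulVec_sqrt_le (s t : ℝ) (z : Fin n → ℝ) :
    c.normQ s (Ψ s t *ᵥ CFC.sqrt (c.BPB t) *ᵥ z) ≤ ‖c.kernel Ψ s t‖ * l2norm z := by
  have h : (c.kernel Ψ s t)ᵀ *ᵥ z = CFC.sqrt (c.Q s) *ᵥ Ψ s t *ᵥ CFC.sqrt (c.BPB t) *ᵥ z := by
    simp only [kernel, Matrix.transpose_mul, Matrix.transpose_transpose, Matrix.transpose_cfcSqrt,
      Matrix.mulVec_mulVec]
  rw [normQ, ← h, ← l2_opNorm_transpose]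
  exact l2norm_mulVec_le _ _

/-- Variation of constants for the backward component. -/
lemma IsHamiltonianFlow.isACDeriv_propagator {ξ η : ℝ → Fin n → ℝ}
    (h : c.IsHamiltonianFlow T ξ η) (hc : c.Admissible T) (hΨ : IsFundamentalSolution T c.A Ψ)
    {t : ℝ} (ht : t ∈ Icc 0 T) (p : Fin n → ℝ) :
    IsACDeriv T (fun s => (Ψ s t *ᵥ p) ⬝ᵥ η s) (fun s =>
      -((Ψ s t *ᵥ p) ⬝ᵥ ((c.Q s + c.calQ s - c.RS s) *ᵥ ξ s - c.RB s *ᵥ η s))) := by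
  refine ((IsVectorACDeriv.mulVec_const (hΨ.isMatrixACDeriv hc.A_bdd ht) p).dotProduct h.2).congr
    (fun _ _ => rfl) fun s _ => ?_
  have h1 : ((c.A s * Ψ s t) *ᵥ p) ⬝ᵥ η s = (Ψ s t *ᵥ p) ⬝ᵥ (c.A s)ᵀ *ᵥ η s := by
    rw [← Matrix.mulVec_mulVec, dotProduct_mulVec_comm, Matrix.transpose_transpose]
  rw [h1]
  simp only [Matrix.sub_mulVec ((c.A s)ᵀ), dotProduct_neg, dotProduct_add, dotProduct_sub]
  ring

namespace PerturbationBound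

variable {a₁ a₂ q r b sa sb : ℝ}

/-- Q contributes the summand 1, and Cauchy–Schwarz in the plane bounds the perturbations
(q+r)|Q^{1/2}x| + b|M^{1/2}y| by `sb` times the root of the weight. -/
lemma dotProduct_source_le (h : c.PerturbationBound T a₁ a₂ q r b) (hc : c.Admissible T)
    (hsb : 0 ≤ sb) (hsb2 : sb ^ 2 = (q + r) ^ 2 + b ^ 2) {s : ℝ}
    (hs : s ∈ Icc 0 T) (x y z : Fin n → ℝ) :
    z ⬝ᵥ ((c.Q s + c.calQ s - c.RS s) *ᵥ x - c.RB s *ᵥ y) ≤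
      c.normQ s z * ((1 + sb) * √(c.weight s x y)) := by
  have h1 := (le_abs_self _).trans (h.calQ s hs z x)
  have h2 := (neg_le_abs _).trans (h.RS s hs z x)
  have h3 := (neg_le_abs _).trans (h.RB s hs z y)
  have h4 : z ⬝ᵥ c.Q s *ᵥ x ≤ c.normQ s z * c.normQ s x := by
    conv_lhs => rw [← CFC.sqrt_mul_sqrt_self (c.Q s) (hc.Q_nonneg s hs).nonneg,
      ← Matrix.mulVec_mulVec, dotProduct_mulVec_comm, Matrix.transpose_cfcSqrt]
    exact (le_abs_self _).trans (abs_dotProduct_le _ _)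
  have hW := Real.sq_sqrt (hc.weight_nonneg hs x y)
  rw [hc.weight_eq hs] at hW ⊢
  have h5 := mul_add_mul_le_of_sq_eq hsb (Real.sqrt_nonneg _) hsb2 hW
  have h6 : c.normQ s x ≤ √(c.normQ s x ^ 2 + c.normM s y ^ 2) :=
    Real.le_sqrt_of_sq_le (by nlinarith [sq_nonneg (c.normM s y)])
  have h7 := mul_le_mul_of_nonneg_left (add_le_add h6 h5) (normQ_nonneg (c := c) s z)
  simp only [Matrix.sub_mulVec, Matrix.add_mulVec, dotProduct_sub, dotProduct_add]
  linarith

lemma dotProduct_terminal_le (h : c.PerturbationBound T a₁ a₂ q r b) (hc : c.Admissible T)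
    (hT : 0 ≤ T) (hsb : 0 ≤ sb) (hsb2 : sb ^ 2 = (q + r) ^ 2 + b ^ 2)
    (x z : Fin n → ℝ) :
    z ⬝ᵥ c.terminal T *ᵥ x ≤ c.normQ T z * ((1 + sb) * c.normQ T x) := by
  have hTm : T ∈ Icc 0 T := ⟨hT, le_rfl⟩
  have h1 := (le_abs_self _).trans (h.calQ T hTm z x)
  have h4 : z ⬝ᵥ c.Q T *ᵥ x ≤ c.normQ T z * c.normQ T x := by
    conv_lhs => rw [← CFC.sqrt_mul_sqrt_self (c.Q T) (hc.Q_nonneg T hTm).nonneg,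
      ← Matrix.mulVec_mulVec, dotProduct_mulVec_comm, Matrix.transpose_cfcSqrt]
    exact (le_abs_self _).trans (abs_dotProduct_le _ _)
  have hq : q ≤ sb := by
    refine le_of_sq_le_sq ?_ hsb
    nlinarith [h.q_nonneg, h.r_nonneg, mul_nonneg h.q_nonneg h.r_nonneg]
  have h5 := mul_le_mul_of_nonneg_right hq
    (mul_nonneg (normQ_nonneg (c := c) T z) (normQ_nonneg (c := c) T x))
  rw [terminal, Matrix.add_mulVec, dotProduct_add]
  linarith

/-- The backward component is controlled by the propagator norm and the total weight. -/
lemma normM_sq_le (h : c.PerturbationBound T a₁ a₂ q r b) (hc : c.Admissible T)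
    (hsb : 0 ≤ sb) (hsb2 : sb ^ 2 = (q + r) ^ 2 + b ^ 2)
    (hΨ : IsFundamentalSolution T c.A Ψ) (hN : c.norm0 T (fun s t => (Ψ s t)ᵀ) ≠ ⊤)
    {ξ η : ℝ → Fin n → ℝ} (hflow : c.IsHamiltonianFlow T ξ η) (hend : η T = c.terminal T *ᵥ ξ T)
    (hint : IntegrableOn (fun t => c.weight t (ξ t) (η t)) (Icc 0 T))
    {t : ℝ} (ht : t ∈ Icc 0 T) :
    c.normM t (η t) ^ 2 ≤ (c.norm0 T (fun s t => (Ψ s t)ᵀ)).toReal ^ 2 *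
      ((1 + sb) ^ 2 * (c.normQ T (ξ T) ^ 2 + ∫ s in t..T, c.weight s (ξ s) (η s))) := by
  have hT : 0 ≤ T := ht.1.trans ht.2
  have hTm : T ∈ Icc 0 T := ⟨hT, le_rfl⟩
  have hsub : ∀ {s}, s ∈ Icc t T → s ∈ Icc 0 T := fun hs => ⟨ht.1.trans hs.1, hs.2⟩
  have hwint : IntervalIntegrable (fun s => c.weight s (ξ s) (η s)) volume t T :=
    (hint.mono_set (uIcc_subset_Icc ht hTm)).intervalIntegrable
  have hI0 : 0 ≤ ∫ s in t..T, c.weight s (ξ s) (η s) :=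
    intervalIntegral.integral_nonneg ht.2 fun s hs => hc.weight_nonneg (hsub hs) _ _
  obtain ⟨hk, hkN⟩ := hc.norm_kernel_sq_integral_le hΨ hN ht
  set N := (c.norm0 T (fun s t => (Ψ s t)ᵀ)).toReal
  set u := c.normQ T (ξ T)
  set v := c.normM t (η t) with hv
  have hv0 : 0 ≤ v := normM_nonneg _ _
  refine sq_le_mul_of_forall_two_mul_le hv0 (sq_nonneg _) (by positivity) fun l hl => ?_
  set z := CFC.sqrt (c.BPB t) *ᵥ η t with hz
  -- Testing with p = M_t η_t makes the pairing at time `t` equal to v², while every later pairing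
  -- is at most the kernel norm times v. One factor v cancels at the end.
  set p := CFC.sqrt (c.BPB t) *ᵥ z with hp
  have hvz : l2norm z = v := rfl
  have hac := hflow.isACDeriv_propagator hc hΨ ht p
  have h1 := hac.integral_eq_sub ht hTm
  have h2 : (Ψ t t *ᵥ p) ⬝ᵥ η t = v ^ 2 := by
    rw [hΨ.apply_self ht, Matrix.one_mulVec, ← hvz, l2norm_sq, dotProduct_comm, hp,
      dotProduct_mulVec_comm, Matrix.transpose_cfcSqrt]
  have hQ : ∀ s, c.normQ s (Ψ s t *ᵥ p) ≤ ‖c.kernel Ψ s t‖ * v := fun s =>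
    normQ_mulVec_sqrt_le s t z
  have h3 : (Ψ T t *ᵥ p) ⬝ᵥ η T ≤
      v * (1 / 2 * (l * ‖c.kernel Ψ T t‖ ^ 2 + (1 + sb) ^ 2 * u ^ 2 / l)) := by
    rw [hend]
    refine (h.dotProduct_terminal_le hc hT hsb hsb2 _ _).trans ?_
    have h4 := mul_le_half_young ‖c.kernel Ψ T t‖ ((1 + sb) * u) hl
    rw [mul_pow] at h4
    have hu : 0 ≤ u := normQ_nonneg _ _
    calc _ ≤ ‖c.kernel Ψ T t‖ * v * ((1 + sb) * u) :=
          mul_le_mul_of_nonneg_right (hQ T) (by positivity)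
      _ = v * (‖c.kernel Ψ T t‖ * ((1 + sb) * u)) := by ring
      _ ≤ _ := mul_le_mul_of_nonneg_left h4 hv0
  have h5 : ∫ s in t..T,
        (Ψ s t *ᵥ p) ⬝ᵥ ((c.Q s + c.calQ s - c.RS s) *ᵥ ξ s - c.RB s *ᵥ η s) ≤
      ∫ s in t..T, v * (1 / 2 * (l * ‖c.kernel Ψ s t‖ ^ 2 +
        (1 + sb) ^ 2 / l * c.weight s (ξ s) (η s))) := by
    refine intervalIntegral.integral_mono_on ht.2 ?_ ?_ fun s hs => ?_
    · simpa only [Pi.neg_def, neg_neg] using (hac.intervalIntegrable ht hTm).neg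
    · exact (((hk.const_mul l).add (hwint.const_mul _)).const_mul _).const_mul _
    · refine (h.dotProduct_source_le hc hsb hsb2 (hsub hs) _ _ _).trans ?_
      have hwn := hc.weight_nonneg (hsub hs) (ξ s) (η s)
      have h4 := mul_le_half_young ‖c.kernel Ψ s t‖ ((1 + sb) * √(c.weight s (ξ s) (η s))) hl
      rw [mul_pow, Real.sq_sqrt hwn, mul_div_right_comm] at h4
      calc _ ≤ ‖c.kernel Ψ s t‖ * v * ((1 + sb) * √(c.weight s (ξ s) (η s))) :=
            mul_le_mul_of_nonneg_right (hQ s) (by positivity)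
        _ = v * (‖c.kernel Ψ s t‖ * ((1 + sb) * √(c.weight s (ξ s) (η s)))) := by ring
        _ ≤ _ := mul_le_mul_of_nonneg_left h4 hv0
  rw [intervalIntegral.integral_const_mul, intervalIntegral.integral_const_mul,
    intervalIntegral.integral_add (hk.const_mul l) (hwint.const_mul _),
    intervalIntegral.integral_const_mul, intervalIntegral.integral_const_mul] at h5
  rw [intervalIntegral.integral_neg, h2] at h1
  set I := ∫ s in t..T, c.weight s (ξ s) (η s)
  set J := ∫ s in t..T, ‖c.kernel Ψ s t‖ ^ 2
  -- The same `l` is used for the terminal term and for the integral, so the kernel terms add up to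
  -- exactly the quantity bounded by N².
  have h6 : v * (2 * v) ≤ v * (l * N ^ 2 + (1 + sb) ^ 2 * (u ^ 2 + I) / l) := by
    have h7 := mul_le_mul_of_nonneg_left hkN (mul_nonneg hv0 hl.le)
    have h8 : (1 + sb) ^ 2 * (u ^ 2 + I) / l = (1 + sb) ^ 2 * u ^ 2 / l + (1 + sb) ^ 2 / l * I := by
      ring
    rw [h8]
    linarith
  rcases hv0.eq_or_lt with h0 | hpos
  · have : 0 ≤ l * N ^ 2 + (1 + sb) ^ 2 * (u ^ 2 + I) / l := by positivity
    linarith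
  · exact le_of_mul_le_mul_left h6 hpos

/-- Uniqueness for the forward-backward system on a short horizon. -/
lemma eq_zero_of_short (h : c.PerturbationBound T a₁ a₂ q r b) (hc : c.Admissible T)
    (hw : c.WeightsInvertible T) (hsa : 0 ≤ sa) (hsa2 : sa ^ 2 = a₁ ^ 2 + a₂ ^ 2)
    (hsb : 0 ≤ sb) (hsb2 : sb ^ 2 = (q + r) ^ 2 + b ^ 2) (hsb1 : sb < 1)
    (hΨ : IsFundamentalSolution T c.A Ψ) (hN : c.norm0 T (fun s t => (Ψ s t)ᵀ) ≠ ⊤)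
    (hlt : T * ((c.norm0 T (fun s t => (Ψ s t)ᵀ)).toReal * sa * (1 + sb)) ^ 2 < (1 - sb) ^ 2)
    {ξ η : ℝ → Fin n → ℝ} {t₀ : ℝ} (ht₀ : t₀ ∈ Icc 0 T) (hflow : c.IsHamiltonianFlow T ξ η)
    (h0 : ξ t₀ = 0) (hend : η T = c.terminal T *ᵥ ξ T) : η t₀ = 0 := by
  rcases ht₀.2.eq_or_lt with rfl | htlt
  · rw [hend, h0, Matrix.mulVec_zero]
  have hT : 0 ≤ T := ht₀.1.trans ht₀.2
  have hTm : T ∈ Icc 0 T := ⟨hT, le_rfl⟩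
  have hsub : ∀ {s}, s ∈ Icc t₀ T → s ∈ Icc 0 T := fun hs => ⟨ht₀.1.trans hs.1, hs.2⟩
  obtain ⟨C, hC⟩ := hc.exists_normM_le hw hT hΨ hN hflow.2
  have hint := hc.integrableOn_weight hflow.1.continuousOn hflow.2.continuousOn hC
  have hwint : ∀ {s}, s ∈ Icc 0 T →
      IntervalIntegrable (fun s => c.weight s (ξ s) (η s)) volume s T := fun hs =>
    (hint.mono_set (uIcc_subset_Icc hs hTm)).intervalIntegrable
  have hwn : ∀ s ∈ Icc 0 T, 0 ≤ c.weight s (ξ s) (η s) := fun s hs => hc.weight_nonneg hs _ _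
  have hI0 : 0 ≤ ∫ s in t₀..T, c.weight s (ξ s) (η s) :=
    intervalIntegral.integral_nonneg ht₀.2 fun s hs => hwn s (hsub hs)
  have hv : ∀ s ∈ Icc t₀ T, c.normM s (η s) ^ 2 ≤
      (c.norm0 T (fun s t => (Ψ s t)ᵀ)).toReal ^ 2 *
        ((1 + sb) ^ 2 * (c.normQ T (ξ T) ^ 2 + ∫ s in t₀..T, c.weight s (ξ s) (η s))) := by
    intro s hs
    refine (h.normM_sq_le hc hsb hsb2 hΨ hN hflow hend hint (hsub hs)).trans ?_
    have hmono : ∫ r in s..T, c.weight r (ξ r) (η r) ≤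
        ∫ r in t₀..T, c.weight r (ξ r) (η r) := by
      refine intervalIntegral.integral_mono_interval hs.1 hs.2 le_rfl ?_ (hwint ht₀)
      exact (ae_restrict_iff' measurableSet_Ioc).2 (.of_forall fun r hr =>
        hwn r (hsub (Ioc_subset_Icc_self hr)))
    gcongr
  set N := (c.norm0 T (fun s t => (Ψ s t)ᵀ)).toReal
  set u := c.normQ T (ξ T)
  set I := ∫ s in t₀..T, c.weight s (ξ s) (η s) with hI
  have hq : q ≤ sb := by
    refine le_of_sq_le_sq ?_ hsb
    nlinarith [h.q_nonneg, h.r_nonneg, mul_nonneg h.q_nonneg h.r_nonneg]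
  have hac := hflow.isACDeriv_dotProduct
  have henergy := hac.integral_eq_sub ht₀ hTm
  simp only [h0, zero_dotProduct, sub_zero, hend] at henergy
  have hter := h.terminal_ge hc hT (ξ T)
  -- The backward perturbations cost at most `sb` times the weight. The forward ones cost `sa`
  -- |M^{1/2}η| √weight, which Young's inequality splits: the square of |M^{1/2}η| has the uniform
  -- bound `hv`, whose integral brings the factor T, and the rest is a multiple of the weight.
  have hmain : ∀ l : ℝ, 0 < l → 2 * ((1 - sb) * (u ^ 2 + I)) ≤
      l * (sa * T * (N ^ 2 * ((1 + sb) ^ 2 * (u ^ 2 + I)))) + sa * (u ^ 2 + I) / l := by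
    intro l hl
    have hrate : ∫ s in t₀..T, c.energyRate s (ξ s) (η s) ≤ ∫ s in t₀..T,
        ((-(1 - sb) + sa * (1 / 2) / l) * c.weight s (ξ s) (η s) +
          sa * (1 / 2) * l * (N ^ 2 * ((1 + sb) ^ 2 * (u ^ 2 + I)))) := by
      refine intervalIntegral.integral_mono_on ht₀.2 (hac.intervalIntegrable ht₀ hTm)
        (((hwint ht₀).const_mul _).add intervalIntegrable_const) fun s hs => ?_
      refine (h.energyRate_le hc hw (hsub hs) _ _).trans ?_
      have hW := Real.sq_sqrt (hwn s (hsub hs))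
      have hvs := hv s hs
      rw [hc.weight_eq (hsub hs)] at hW ⊢
      set x := c.normQ s (ξ s)
      set y := c.normM s (η s)
      have hx : 0 ≤ x := normQ_nonneg _ _
      have hy : 0 ≤ y := normM_nonneg _ _
      set w := √(x ^ 2 + y ^ 2)
      have hw0 : 0 ≤ w := Real.sqrt_nonneg _
      have e1 := mul_le_mul_of_nonneg_right
        (mul_add_mul_le_of_sq_eq hsb hw0 hsb2 hW) hx
      have e2 := mul_le_mul_of_nonneg_right
        (mul_add_mul_le_of_sq_eq hsa hw0 hsa2 hW) hy
      have e3 : x ≤ w := Real.le_sqrt_of_sq_le (by nlinarith [sq_nonneg y])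
      have e4 : sb * w * x ≤ sb * w ^ 2 := by
        rw [sq, ← mul_assoc]
        exact mul_le_mul_of_nonneg_left e3 (by positivity)
      have e5 := mul_le_mul_of_nonneg_left (mul_le_half_young y w hl) hsa
      have e6 := mul_le_mul_of_nonneg_left hvs (by positivity : 0 ≤ sa * (1 / 2) * l)
      have e7 : sa * (1 / 2 * (l * y ^ 2 + w ^ 2 / l)) =
          sa * (1 / 2) * l * y ^ 2 + sa * (1 / 2) / l * w ^ 2 := by ring
      rw [← hW]
      linarith
    rw [intervalIntegral.integral_add ((hwint ht₀).const_mul _) intervalIntegrable_const,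
      intervalIntegral.integral_const_mul, intervalIntegral.integral_const, henergy, ← hI,
      smul_eq_mul] at hrate
    have f1 : (1 - sb) * u ^ 2 ≤ (1 - q) * u ^ 2 :=
      mul_le_mul_of_nonneg_right (by linarith) (sq_nonneg _)
    have f2 : (T - t₀) * (sa * (1 / 2) * l * (N ^ 2 * ((1 + sb) ^ 2 * (u ^ 2 + I)))) ≤
        T * (sa * (1 / 2) * l * (N ^ 2 * ((1 + sb) ^ 2 * (u ^ 2 + I)))) :=
      mul_le_mul_of_nonneg_right (by linarith [ht₀.1]) (by positivity)
    -- This term is added only so that both sides involve the same quantity u² + I.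
    have f3 : 0 ≤ sa * u ^ 2 / l := by positivity
    have f4 : sa * (u ^ 2 + I) / l = sa * u ^ 2 / l + 2 * (sa * (1 / 2) / l * I) := by ring
    rw [f4]
    linarith
  have hX0 : 0 ≤ u ^ 2 + I := by positivity
  have hsq := sq_le_mul_of_forall_two_mul_le (mul_nonneg (by linarith) hX0) (by positivity)
    (mul_nonneg hsa hX0) hmain
  have hX : u ^ 2 + I = 0 := by
    by_contra hne
    have hpos : 0 < (u ^ 2 + I) ^ 2 := by positivity
    have : ((1 - sb) ^ 2) * (u ^ 2 + I) ^ 2 ≤ (T * (N * sa * (1 + sb)) ^ 2) * (u ^ 2 + I) ^ 2 := by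
      linarith
    exact absurd (le_of_mul_le_mul_right this hpos) (not_le.2 hlt)
  have hIz : I = 0 := by nlinarith [sq_nonneg u]
  -- The weight has zero integral, hence vanishes almost everywhere, and invertibility of M turns
  -- this into η = 0.
  refine eq_zero_of_integral_nonneg htlt (hwint ht₀).neg (fun s hs => ⟨?_, fun hs0 => ?_⟩) ?_
    (hflow.2.continuousOn.mono (Icc_subset_Icc_left ht₀.1))
  · exact neg_nonpos.2 (hwn s (hsub hs))
  · have hz : c.weight s (ξ s) (η s) = 0 := neg_eq_zero.1 hs0
    rw [hc.weight_eq (hsub hs)] at hz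
    refine hc.eq_zero_of_normM hw (hsub hs) ?_
    nlinarith [sq_nonneg (c.normQ s (ξ s)), sq_nonneg (c.normM s (η s))]
  · have : ∫ s in t₀..T, (-fun s => c.weight s (ξ s) (η s)) s = 0 := by
      simp only [Pi.neg_apply, intervalIntegral.integral_neg]
      rw [← hI, hIz, neg_zero]
    exact this.ge

end PerturbationBound

/-- Uniqueness for the forward-backward system under the short horizon condition. -/
lemma Condition2.unique (hT : 0 ≤ T) (hc : c.Admissible T) (h : c.Condition2 T)
    (ξ η : ℝ → Fin n → ℝ) (t₀ : ℝ) (ht₀ : t₀ ∈ Icc 0 T) (hflow : c.IsHamiltonianFlow T ξ η)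
    (h0 : ξ t₀ = 0) (hend : η T = c.terminal T *ᵥ ξ T) : η t₀ = 0 := by
  obtain ⟨T₀, hc₀, hw₀, hf0, hb1, hTT, Ψ, hΨ, hlt⟩ := h
  -- For n = 0 the propagator norm is 0; otherwise it is positive, since at t = T the kernel is the
  -- invertible matrix M_T^{1/2} Q_T^{1/2}.
  rcases isEmpty_or_nonempty (Fin n) with hn | hn
  · exact Subsingleton.elim _ _
  have hTm : T ∈ Icc 0 T := ⟨hT, le_rfl⟩
  have hw : c.WeightsInvertible T := fun t ht => hw₀ t ⟨ht.1, ht.2.trans hTT.le⟩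
  have hN0 : c.norm0 T (fun s t => (Ψ s t)ᵀ) ≠ 0 := by
    intro hz
    have h1 := kernel_le_norm0 (c := c) (Ψ := Ψ) hTm
    rw [hz, zero_pow two_ne_zero] at h1
    have h2 : c.kernel Ψ T T = 0 := by
      have := (add_eq_zero.1 (le_antisymm h1 zero_le)).1
      simpa using this
    rw [kernel, hΨ.apply_self hTm, Matrix.transpose_one, Matrix.mul_one] at h2
    have h3 := (hc.isUnit_sqrt_BPB hw hTm).mul (hc.isUnit_sqrt_Q hw hTm)
    rw [h2] at h3
    exact not_isUnit_zero h3
  have hf0' : c.fwdSize T₀ ^ (1 / 2 : ℝ) ≠ 0 := by simpa using hf0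
  -- An infinite product would make the horizon bound 0. As neither factor vanishes and 0·∞ = 0 is
  -- thereby excluded, both factors are finite.
  have hprod : c.norm0 T (fun s t => (Ψ s t)ᵀ) * c.fwdSize T₀ ^ (1 / 2 : ℝ) ≠ ⊤ := by
    intro htop
    rw [htop, ENNReal.div_top, zero_mul, zero_pow two_ne_zero] at hlt
    exact not_lt_zero hlt
  have hN : c.norm0 T (fun s t => (Ψ s t)ᵀ) ≠ ⊤ := fun htop =>
    hprod (by rw [htop, ENNReal.top_mul hf0'])
  have hf : c.fwdSize T₀ ≠ ⊤ := fun htop =>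
    hprod (by rw [htop, ENNReal.top_rpow_of_pos (by norm_num), ENNReal.mul_top hN0])
  obtain ⟨a₁, a₂, q, r, b, hB, h1, h2⟩ := exists_perturbationBound hc₀ hw₀ hf (ne_top_of_lt hb1)
  have hsqrt : ∀ x : ℝ, 0 ≤ x → ENNReal.ofReal x ^ (1 / 2 : ℝ) = ENNReal.ofReal √x := fun x hx => by
    rw [ENNReal.ofReal_rpow_of_nonneg hx (by norm_num), Real.sqrt_eq_rpow]
  have hsb1 : √((q + r) ^ 2 + b ^ 2) < 1 := by
    rw [h2, ENNReal.ofReal_lt_one] at hb1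
    rw [Real.sqrt_lt' one_pos]
    simpa using hb1
  have hsa : 0 < √(a₁ ^ 2 + a₂ ^ 2) := by
    rw [Real.sqrt_pos]
    by_contra! hle
    rw [h1, ENNReal.ofReal_eq_zero.2 hle] at hf0
    exact hf0 rfl
  rw [h1, h2, hsqrt _ (by positivity), hsqrt _ (by positivity)] at hlt
  refine (hB.mono hTT.le).eq_zero_of_short hc hw (Real.sqrt_nonneg _)
    (Real.sq_sqrt (by positivity)) (Real.sqrt_nonneg _) (Real.sq_sqrt (by positivity)) hsb1 hΨ hN
    ?_ ht₀ hflow h0 hend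
  set N := c.norm0 T (fun s t => (Ψ s t)ᵀ)
  set sa := √(a₁ ^ 2 + a₂ ^ 2)
  set sb := √((q + r) ^ 2 + b ^ 2)
  have hsb : 0 ≤ sb := Real.sqrt_nonneg _
  have hNpos : 0 < N.toReal := ENNReal.toReal_pos hN0 hN
  have hr : (1 / (N * ENNReal.ofReal sa) * ((1 - ENNReal.ofReal sb) / (1 + ENNReal.ofReal sb))) ^ 2
      = ENNReal.ofReal ((1 / (N.toReal * sa) * ((1 - sb) / (1 + sb))) ^ 2) := by
    rw [ENNReal.ofReal_pow (by have : 0 ≤ 1 - sb := by linarith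
                               positivity),
      ENNReal.ofReal_mul (by positivity), ENNReal.ofReal_div_of_pos (by positivity),
      ENNReal.ofReal_div_of_pos (by positivity), ENNReal.ofReal_mul hNpos.le,
      ENNReal.ofReal_toReal hN, ENNReal.ofReal_sub _ hsb, ENNReal.ofReal_add zero_le_one hsb,
      ENNReal.ofReal_one]
  rw [hr, ENNReal.ofReal_lt_ofReal_iff_of_nonneg hT, div_mul_div_comm, one_mul, div_pow,
    lt_div_iff₀ (by positivity)] at hlt
  exact hlt

end LQCoeff

/-! ### The theorem -/

theorem mainTheorem4 {n m : ℕ} (c : LQCoeff n m) (T : ℝ) (hT : 0 < T)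
    (hc : c.Admissible T)
    (hcond : c.Condition1 T ∨ c.Condition2 T ∨ c.Condition3 T) :
    (∃ Φ, IsFundamentalSolution T c.hamiltonian Φ) ∧
    ∃ Γ : ℝ → Matrix (Fin n) (Fin n) ℝ,
      c.IsRiccatiSolution T Γ ∧
      (∀ Γ' : ℝ → Matrix (Fin n) (Fin n) ℝ, c.IsRiccatiSolution T Γ' →
        ∀ t ∈ Set.Icc 0 T, Γ' t = Γ t) ∧
      (∀ Φ, IsFundamentalSolution T c.hamiltonian Φ → ∀ t ∈ Set.Icc 0 T,
        IsUnit (c.lowerBlock T Φ t) ∧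
        Γ t = -((c.lowerBlock T Φ t)⁻¹ * c.upperBlock T Φ t)) ∧
      (∀ (x₀ : Fin n → ℝ) (ξ η : ℝ → Fin n → ℝ), c.IsFBODESolution T x₀ ξ η →
        ∀ t ∈ Set.Icc 0 T, η t = (Γ t).mulVec (ξ t)) := by
  refine LQCoeff.riccati_of_unique hT.le hc ?_
  rcases hcond with h | h | h
  · exact h.unique hT.le hc
  · exact h.unique hT.le hc
  · exact h.unique hT.le hc
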